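/- Let $\tau$ be a relational first-order language (no function or constant symbols) and let $M^1,M^2$ be (nonempty) $\tau$-structures with disjoint universes. Let $M^1\oplus M^2$ be the structure in the language $\tau\cup\{L,R\}$ ($L,R$ new unary predicates) with universe $|M^1|\cup|M^2|$, in which $S^{M^1\oplus M^2}=S^{M^1}\cup S^{M^2}$ for every $S\in\tau$, $L^{M^1\oplus M^2}=|M^1|$ and $R^{M^1\oplus M^2}=|M^2|$. Then for each $\ell\in\{1,2,3\}$: $\mathrm{Th}(M^1\oplus M^2)$ is strongly dependent$_\ell$ if and only if both $\mathrm{Th}(M^1)$ and $\mathrm{Th}(M^2)$ are strongly dependent$_\ell$. Here the notions are as follows, for a complete theory $T$ with universal domain (monster model) $\mathfrak C$. A type is a finitely satisfiable set $p(\bar x)$ of formulas with parameters, $\bar x$ a finite tuple of variables; $\mathrm{Dom}(p)$ is its set of parameters. Indiscernible sequences are indexed by infinite linear orders and consist of finite tuples. For $n<\omega$ and a set $A$, we say that $p(\bar x)$ does $\mathrm{ict}^\ell$-$n$-divide over $A$ if there are an infinite linear order $I$, elements $s_0<t_0\le s_1<t_1\le\dots\le s_{n-1}<t_{n-1}$ of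 $I$, and - ($\ell=1$) a sequence $\langle\bar a_t:t\in I\rangle$ indiscernible over $A$ such that for every $\bar c$ realizing $p$ and every $i<n$, $\mathrm{tp}(\bar c^\frown\bar a_{s_i}/A)\ne\mathrm{tp}(\bar c^\frown\bar a_{t_i}/A)$; - ($\ell=2$) a sequence $\langle\bar a_t:t\in I\rangle$ indiscernible over $A$ such that for every $\bar c$ realizing $p$ and every $i<n$, $\mathrm{tp}(\bar c^\frown\bar a_{s_i}/A\cup\{\bar a_{s_j}:j<i\})\ne\mathrm{tp}(\bar c^\frown\bar a_{t_i}/A\cup\{\bar a_{s_j}:j<i\})$; - ($\ell=3$) a structure $\langle\bar a_t:t\in I\cup\mathrm{incr}(<n,I)\rangle$ indiscernible over $A$ such that for every $\bar c$ realizing $p$ and every $i<n$, $\mathrm{tp}(\bar c^\frown\bar a_{s_i}/A\cup\bar a_{\langle s_0,\dots,s_{i-1}\rangle})\ne\mathrm{tp}(\bar c^\frown\bar a_{t_i}/A\cup\bar a_{\langle s_0,\dots,s_{i-1}\rangle})$. Here $\mathrm{incr}(<n,I)$ is the set of strictly increasing sequences of length $<n$ in $I$, the (finite) length of $\bar a_t$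 depends only on whether $t\in I$ or $t$ is a sequence of a given length, and indiscernible over $A$ means: for any two increasing sequences $f,g$ of the same finite length $r$ in $I$, the family of all $\bar a_t$ with $t$ a member of $f$ or an increasing sequence of length $<n$ of members of $f$ has the same type over $A$ as the corresponding family for $g$. The type $p$ does $\mathrm{ict}^\ell$-$n$-fork over $A$ if $p(\bar x)\vdash\bigvee_{i<m}\varphi_i(\bar x,\bar c_i)$ for finitely many formulas $\varphi_i(\bar x,\bar c_i)$ with parameters in $\mathfrak C$, each of which does $\mathrm{ict}^\ell$-$n$-divide over $A$. Finally, $\kappa_{\mathrm{ict},\ell}(T)>\kappa$ means that some type $p$ does $\mathrm{ict}^\ell$-$n$-fork over $A$ for all $n<\omega$ and all $A\subseteq\mathrm{Dom}(p)$ with $|A|<\kappa$, and $T$ is strongly dependent$_\ell$ if $\kappa_{\mathrm{ict},\ell}(T)>\aleph_0$ fails (i.e. $\kappa_{\mathrm{ict},\ell}(T)=\aleph_0$, where $\kappa$ ranges over infinite cardinals). -/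

import Mathlib

open FirstOrder Cardinal

universe u v w₁ w₂

namespace StrongDep

/-! ### The disjoint sum of two structures in a relational language -/

/-- The symbols of two new unary predicates `L` (left part) and `R` (right part). -/
inductive SideRel : ℕ → Type
  | left : SideRel 1
  | right : SideRel 1

/-- The language with exactly two symbols, the unary predicates `L` and `R`. -/
def sideLanguage : FirstOrder.Language.{0, 0} := ⟨fun _ => Empty, SideRel⟩

/-- The language `τ ∪ {L, R}`. -/
abbrev sumLanguage (τ : FirstOrder.Language.{u, v}) : FirstOrder.Language.{u, v} := τ.sum sideLanguage

/-- The universe of the sum of `M₁` and `M₂`: the disjoint union. -/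
def DisjointSum (M₁ : Type w₁) (M₂ : Type w₂) : Type (max w₁ w₂) := M₁ ⊕ M₂

section Sum

variable {τ : FirstOrder.Language.{u, v}} {M₁ : Type w₁} {M₂ : Type w₂}

/-- The `τ`-structure on the disjoint union: `S` is interpreted as `S^{M₁} ∪ S^{M₂}`. -/
instance sumBaseStructure [τ.IsRelational] [τ.Structure M₁] [τ.Structure M₂] :
    τ.Structure (DisjointSum M₁ M₂) where
  funMap f _ := isEmptyElim f
  RelMap {n} S x :=
    (∃ y : Fin n → M₁, (∀ i, x i = Sum.inl (y i)) ∧ FirstOrder.Language.Structure.RelMap S y) ∨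
      (∃ y : Fin n → M₂, (∀ i, x i = Sum.inr (y i)) ∧ FirstOrder.Language.Structure.RelMap S y)

/-- `L` is interpreted as the universe of `M₁` and `R` as the universe of `M₂`. -/
instance sumSideStructure : sideLanguage.Structure (DisjointSum M₁ M₂) where
  funMap f _ := Empty.elim f
  RelMap S x :=
    match S, x with
    | SideRel.left, x => ∃ a : M₁, x 0 = Sum.inl a
    | SideRel.right, x => ∃ b : M₂, x 0 = Sum.inr b

/-- The structure `M₁ ⊕ M₂` in the language `τ ∪ {L, R}`. -/
instance disjointSumStructure [τ.IsRelational] [τ.Structure M₁] [τ.Structure M₂] :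
    (sumLanguage τ).Structure (DisjointSum M₁ M₂) :=
  FirstOrder.Language.sumStructure τ sideLanguage (DisjointSum M₁ M₂)

end Sum

/-! ### Types and indiscernible structures

A formula `φ(x)` with parameters from a set `B` in the variables `x = (x_i : i ∈ α)` is an
element of `L.Formula (B ⊕ α)`. -/

section Types

variable {L : FirstOrder.Language.{u, v}} {N : Type w₁} [L.Structure N]

/-- `tp(u / A) = tp(v / A)` in the structure `N`. -/
def SameType (L : FirstOrder.Language.{u, v}) {N : Type w₁} [L.Structure N] {α : Type} (A : Set N)
    (u v : α → N) : Prop :=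
  ∀ φ : L.Formula (A ⊕ α),
    φ.Realize (Sum.elim (fun a : A => (a : N)) u) ↔
      φ.Realize (Sum.elim (fun a : A => (a : N)) v)

/-- `c` realizes the set `p` of formulas over `B`, whose parameters are moved by `h`. -/
def Realizes {N' : Type w₂} [L.Structure N'] {B : Set N} {m : ℕ}
    (h : N → N') (p : Set (L.Formula (B ⊕ Fin m))) (c : Fin m → N') : Prop :=
  ∀ φ ∈ p, φ.Realize (Sum.elim (fun b : B => h b) c)

/-- `⟨a_t : t ∈ I⟩` is an indiscernible sequence of `k`-tuples over `A`. -/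
def IsIndiscernibleSeq (L : FirstOrder.Language.{u, v}) {N : Type w₁} [L.Structure N] {I : Type w₂}
    [LinearOrder I] {k : ℕ} (A : Set N) (a : I → Fin k → N) : Prop :=
  ∀ (r : ℕ) (f g : Fin r ↪o I),
    SameType L A (fun x : Fin r × Fin k => a (f x.1) x.2)
      (fun x : Fin r × Fin k => a (g x.1) x.2)

/-- `⟨a_t : t ∈ I⟩` together with `⟨b_η : η ∈ incr(<n, I)⟩` is an indiscernible structure over
`A`, indexed by the linear order `I` and its increasing sequences of length `< n`, each such
sequence being linked to its coordinates. A sequence of length `i` is an element of `Fin i ↪o I`.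
The length of a tuple depends only on the kind of its index. Finite tuples of indices which are
built in the same way from two finite increasing sequences `f`, `g` of equal length
yield tuples of the same type over `A`. -/
def IsIndiscernibleStr (L : FirstOrder.Language.{u, v}) {N : Type w₁} [L.Structure N] {I : Type w₂}
    [LinearOrder I] {k : ℕ} (n : ℕ) {k' : Fin n → ℕ} (A : Set N) (a : I → Fin k → N)
    (b : ∀ i : Fin n, (Fin (i : ℕ) ↪o I) → Fin (k' i) → N) : Prop :=
  ∀ (r : ℕ) (f g : Fin r ↪o I),
    SameType L A
      (Sum.elim (fun x : Fin r × Fin k => a (f x.1) x.2)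
        (fun x : Σ i : Fin n, (Fin (i : ℕ) ↪o Fin r) × Fin (k' i) =>
          b x.1 (x.2.1.trans f) x.2.2))
      (Sum.elim (fun x : Fin r × Fin k => a (g x.1) x.2)
        (fun x : Σ i : Fin n, (Fin (i : ℕ) ↪o Fin r) × Fin (k' i) =>
          b x.1 (x.2.1.trans g) x.2.2))

/-- `s_0 < t_0 ≤ s_1 < t_1 ≤ … ≤ s_{n-1} < t_{n-1}`. -/
def Interlaced {I : Type w₁} [LinearOrder I] {n : ℕ} (s : Fin n ↪o I) (t : Fin n → I) : Prop :=
  (∀ i, s i < t i) ∧ ∀ i j, i < j → t i ≤ s j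

/-- The initial segment `⟨s_0, …, s_{i-1}⟩` of the increasing sequence `s`. -/
def initialSeg {I : Type w₁} [LinearOrder I] {n : ℕ} (s : Fin n ↪o I) (i : Fin n) :
    Fin (i : ℕ) ↪o I :=
  (Fin.castLEOrderEmb i.isLt.le).trans s

end Types

/-! ### Dividing and forking

The universal domain of a complete theory `T` is replaced by the system of all models of `T`
and elementary embeddings: an object which exists in the universal domain is an object of some
elementary extension, and a property of all tuples of the universal domain is a property of all
tuples of all further elementary extensions. -/

section Dividing

variable {L : FirstOrder.Language.{u, v}} {T : L.Theory}

/-- The three kinds of dividing. -/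
inductive IctKind : Type
  | one
  | two
  | three

/-- The set `p` of formulas over `B` does `ict¹`-`n`-divide over `A`. -/
def IctDividesOne (n : ℕ) {N : FirstOrder.Language.Theory.ModelType.{u, v, max u v} T} (A : Set N) {B : Set N}
    {m : ℕ} (p : Set (L.Formula (B ⊕ Fin m))) : Prop :=
  ∃ (N' : FirstOrder.Language.Theory.ModelType.{u, v, max u v} T) (f : N ↪ₑ[L] N')
    (I : Type (max u v)) (_ : LinearOrder I) (_ : Infinite I) (k : ℕ) (a : I → Fin k → N')
    (s : Fin n ↪o I) (t : Fin n → I),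
    IsIndiscernibleSeq L (f '' A) a ∧ Interlaced s t ∧
      ∀ (N'' : FirstOrder.Language.Theory.ModelType.{u, v, max u v} T) (g : N' ↪ₑ[L] N'') (c : Fin m → N''),
        Realizes (g ∘ f) p c → ∀ i : Fin n,
          ¬ SameType L ((g ∘ f) '' A)
            (Sum.elim c (g ∘ a (s i))) (Sum.elim c (g ∘ a (t i)))

/-- The set `p` of formulas over `B` does `ict²`-`n`-divide over `A`. -/
def IctDividesTwo (n : ℕ) {N : FirstOrder.Language.Theory.ModelType.{u, v, max u v} T} (A : Set N) {B : Set N}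
    {m : ℕ} (p : Set (L.Formula (B ⊕ Fin m))) : Prop :=
  ∃ (N' : FirstOrder.Language.Theory.ModelType.{u, v, max u v} T) (f : N ↪ₑ[L] N')
    (I : Type (max u v)) (_ : LinearOrder I) (_ : Infinite I) (k : ℕ) (a : I → Fin k → N')
    (s : Fin n ↪o I) (t : Fin n → I),
    IsIndiscernibleSeq L (f '' A) a ∧ Interlaced s t ∧
      ∀ (N'' : FirstOrder.Language.Theory.ModelType.{u, v, max u v} T) (g : N' ↪ₑ[L] N'') (c : Fin m → N''),
        Realizes (g ∘ f) p c → ∀ i : Fin n,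
          ¬ SameType L ((g ∘ f) '' A ∪ {y | ∃ j, j < i ∧ y ∈ Set.range (g ∘ a (s j))})
            (Sum.elim c (g ∘ a (s i))) (Sum.elim c (g ∘ a (t i)))

/-- The set `p` of formulas over `B` does `ict³`-`n`-divide over `A`. -/
def IctDividesThree (n : ℕ) {N : FirstOrder.Language.Theory.ModelType.{u, v, max u v} T} (A : Set N) {B : Set N}
    {m : ℕ} (p : Set (L.Formula (B ⊕ Fin m))) : Prop :=
  ∃ (N' : FirstOrder.Language.Theory.ModelType.{u, v, max u v} T) (f : N ↪ₑ[L] N')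
    (I : Type (max u v)) (_ : LinearOrder I) (_ : Infinite I)
    (k : ℕ) (a : I → Fin k → N')
    (k' : Fin n → ℕ) (b : ∀ i : Fin n, (Fin (i : ℕ) ↪o I) → Fin (k' i) → N')
    (s : Fin n ↪o I) (t : Fin n → I),
    IsIndiscernibleStr L n (f '' A) a b ∧ Interlaced s t ∧
      ∀ (N'' : FirstOrder.Language.Theory.ModelType.{u, v, max u v} T) (g : N' ↪ₑ[L] N'') (c : Fin m → N''),
        Realizes (g ∘ f) p c → ∀ i : Fin n,
          ¬ SameType L ((g ∘ f) '' A ∪ Set.range (g ∘ b i (initialSeg s i)))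
            (Sum.elim c (g ∘ a (s i))) (Sum.elim c (g ∘ a (t i)))

/-- The set `p` of formulas over `B` does `ict^ℓ`-`n`-divide over `A`. -/
def IctDivides (ℓ : IctKind) (n : ℕ) {N : FirstOrder.Language.Theory.ModelType.{u, v, max u v} T} (A : Set N)
    {B : Set N} {m : ℕ} (p : Set (L.Formula (B ⊕ Fin m))) : Prop :=
  match ℓ with
  | .one => IctDividesOne n A p
  | .two => IctDividesTwo n A p
  | .three => IctDividesThree n A p

/-- The set `p` of formulas over `B` does `ict^ℓ`-`n`-fork over `A`: it implies a finite
disjunction of formulas (with any parameters) each of which does `ict^ℓ`-`n`-divide over `A`. -/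
def IctForks (ℓ : IctKind) (n : ℕ) {N : FirstOrder.Language.Theory.ModelType.{u, v, max u v} T} (A : Set N)
    {B : Set N} {m : ℕ} (p : Set (L.Formula (B ⊕ Fin m))) : Prop :=
  ∃ (N' : FirstOrder.Language.Theory.ModelType.{u, v, max u v} T) (f : N ↪ₑ[L] N') (C : Set N') (r : ℕ)
    (φ : Fin r → L.Formula (C ⊕ Fin m)),
    (∀ (N'' : FirstOrder.Language.Theory.ModelType.{u, v, max u v} T) (g : N' ↪ₑ[L] N'') (c : Fin m → N''),
        Realizes (g ∘ f) p c → ∃ i, Realizes g {φ i} c) ∧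
      ∀ i, IctDivides ℓ n (f '' A) {φ i}

/-- The set `p` of formulas over `B` is a type: it is finitely satisfiable. -/
def IsType {N : FirstOrder.Language.Theory.ModelType.{u, v, max u v} T} {B : Set N} {m : ℕ}
    (p : Set (L.Formula (B ⊕ Fin m))) : Prop :=
  ∀ q ⊆ p, q.Finite → ∃ c : Fin m → N, Realizes id q c

/-- `κ_{ict,ℓ}(T) > κ`: some type `p`, over a set `B`, does `ict^ℓ`-`n`-fork over `A` for all
`n < ω` and all `A ⊆ B` of power `< κ`. -/
def KappaIctGT (ℓ : IctKind) (T : L.Theory) (κ : Cardinal.{max u v}) : Prop :=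
  ∃ (N : FirstOrder.Language.Theory.ModelType.{u, v, max u v} T) (B : Set N) (m : ℕ)
    (p : Set (L.Formula (B ⊕ Fin m))),
    IsType p ∧ ∀ (n : ℕ) (A : Set N), A ⊆ B → #A < κ → IctForks ℓ n A p

/-- `T` is strongly dependent_ℓ: `κ_{ict,ℓ}(T)`, an infinite cardinal, is `ℵ₀`. -/
def StronglyDependent (ℓ : IctKind) (T : L.Theory) : Prop :=
  ¬ KappaIctGT ℓ T ℵ₀

end Dividing

end StrongDep

/-! Types in a sum are governed by types in the summands. A formula over a sum, with its variables
assigned to sides, is a finite disjunction of conjunctions of a left and a right formula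
(`realize_decompose`, `IsSum.eqTp`). Conversely, formulas of a summand relativize to the sum
(`IsSide.realize_relativize`), and each model of the theory of the sum splits into models of the two
theories (`exists_split`). Hence elementary maps, realizations and indiscernible structures can be
passed between a sum and its sides.

The three kinds of dividing are treated uniformly through `Config`. By compactness, forking can be
stated without formulas: in some elementary extension, each realization is distinguished by a
configuration of that extension, which may depend on the realization
(`IctForks.exists_isDistinguished`, `ictForks_of_isDistinguished`). The configuration can moreover
be indexed by `ℕ`, with `s i = M * i` and `t i` equal to `M * i + 1` or `M * (i + 1)`, for any
prescribed gap `M ≥ 2` (`Config.exists_stretch`).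

If a summand is not strongly dependent, adding a fixed model of the other theory carries a witness
over to the sum (`IsSumRelation.kappaIctGT`).

For the other direction, split a type over `B` in the sum into its two parts, and suppose that these
do not fork over finite sets `A₁`, `A₂`, for `n₁` and `n₂` respectively. Undistinguished
realizations of the two parts, chosen independently, combine to a realization of the whole. A
configuration distinguishing `2 * n₁ + 2 * n₂` pairs for it would distinguish each of these pairs on
at least one side. A side then sees only some of the pairs, while the parameters attached to `⟨s 0,
…, s (i - 1)⟩` also involve the others. This is overcome in `Config.card_differs_lt`: out of `2 *
n₁` pairs distinguished on the left, every second one is kept, and the indices in between are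
absorbed into blocks, which yields a configuration with `n₁` distinguished pairs and no parameter
lost. So fewer than `2 * n₁` pairs are distinguished on the left and fewer than `2 * n₂` on the
right. Some pair is distinguished on neither side, hence not in the sum. -/

namespace StrongDep

/-! ### Equality of types across structures. -/

section EqTp

open FirstOrder.Language

variable {L : FirstOrder.Language.{u, v}}

/-- The tuples `x` and `y`, which may live in different structures, satisfy the same formulas. -/
def EqTp (L : FirstOrder.Language.{u, v}) {N N' α : Type*} [L.Structure N] [L.Structure N']
    (x : α → N) (y : α → N') : Prop :=
  ∀ φ : L.Formula α, φ.Realize x ↔ φ.Realize y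

variable {N N' N'' α β γ : Type*} [L.Structure N] [L.Structure N'] [L.Structure N'']

theorem EqTp.symm {x : α → N} {y : α → N'} (h : EqTp L x y) : EqTp L y x := fun φ => (h φ).symm

theorem EqTp.trans {x : α → N} {y : α → N'} {z : α → N''} (h : EqTp L x y) (h' : EqTp L y z) :
    EqTp L x z := fun φ => (h φ).trans (h' φ)

theorem EqTp.comp {x : α → N} {y : α → N'} (h : EqTp L x y) (e : β → α) :
    EqTp L (x ∘ e) (y ∘ e) := fun φ => by
  simpa [Formula.realize_relabel] using h (φ.relabel e)

theorem EqTp.of_comp {x : α → N} {y : α → N'} {x' : β → N} {y' : β → N'} (h : EqTp L x y)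
    (e : β → α) (hx : ∀ b, x' b = x (e b)) (hy : ∀ b, y' b = y (e b)) : EqTp L x' y' := by
  rw [show x' = x ∘ e from funext hx, show y' = y ∘ e from funext hy]
  exact h.comp e

theorem EqTp.eq_iff {x : α → N} {y : α → N'} (h : EqTp L x y) (i j : α) :
    x i = x j ↔ y i = y j := by
  simpa using h (Term.equal (Term.var i) (Term.var j))

theorem eqTp_embedding (f : N ↪ₑ[L] N') (x : α → N) : EqTp L (f ∘ x) x :=
  fun φ => f.map_formula φ x

theorem EqTp.exists_embedding {f : N → N'} (h : EqTp L f (id : N → N)) :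
    ∃ g : N ↪ₑ[L] N', ∀ x, g x = f x :=
  ⟨⟨f, fun _ φ x => (h.comp x φ)⟩, fun _ => rfl⟩

theorem sameType_iff_eqTp {α : Type} {A : Set N} {γ : Type*} (e : γ → N)
    (he : Set.range e = A) (x y : α → N) :
    SameType L A x y ↔ EqTp L (Sum.elim e x) (Sum.elim e y) := by
  subst he
  constructor
  · intro h
    refine EqTp.of_comp (x := Sum.elim (fun a : Set.range e => (a : N)) x)
      (y := Sum.elim (fun a : Set.range e => (a : N)) y) h
      (Sum.map (fun c => ⟨e c, c, rfl⟩) id) ?_ ?_ <;> rintro (b | b) <;> rfl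
  · intro h
    refine EqTp.of_comp h (Sum.map (fun c : Set.range e => c.2.choose) id) ?_ ?_ <;>
      rintro (b | b) <;> first | rfl | exact b.2.choose_spec.symm

theorem SameType.eqTp {α : Type} {A : Set N} {γ : Type*} (e : γ → N)
    (he : ∀ c, e c ∈ A) {x y : α → N} (h : SameType L A x y) :
    EqTp L (Sum.elim e x) (Sum.elim e y) := by
  refine EqTp.of_comp (x := Sum.elim (fun a : A => (a : N)) x)
      (y := Sum.elim (fun a : A => (a : N)) y) h
      (Sum.map (fun c => ⟨e c, he c⟩) id) ?_ ?_ <;> rintro (b | b) <;> rfl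

theorem SameType.mono {α : Type} {A B : Set N} {x y : α → N} (h : SameType L B x y) (hA : A ⊆ B) :
    SameType L A x y :=
  (sameType_iff_eqTp (fun a : A => (a : N)) (by simp) x y).2 (h.eqTp _ fun a => hA a.2)

theorem SameType.comp {α β : Type} {A : Set N} {x y : α → N} {x' y' : β → N}
    (h : SameType L A x y) (e : β → α) (hx : ∀ b, x' b = x (e b)) (hy : ∀ b, y' b = y (e b)) :
    SameType L A x' y' :=
  EqTp.of_comp (x := Sum.elim (fun a : A => (a : N)) x)
      (y := Sum.elim (fun a : A => (a : N)) y) h (Sum.map id e)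
      (by rintro (b | b) <;> simp [hx]) (by rintro (b | b) <;> simp [hy])

theorem SameType.symm {α : Type} {A : Set N} {x y : α → N} (h : SameType L A x y) :
    SameType L A y x := fun φ => (h φ).symm

theorem SameType.trans {α : Type} {A : Set N} {x y z : α → N} (h : SameType L A x y)
    (h' : SameType L A y z) : SameType L A x z := fun φ => (h φ).trans (h' φ)

theorem sameType_image {α : Type} {A : Set N} (f : N ↪ₑ[L] N') (x y : α → N) :
    SameType L (f '' A) (f ∘ x) (f ∘ y) ↔ SameType L A x y := by
  rw [sameType_iff_eqTp (fun a : A => f a) (by ext; simp),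
    sameType_iff_eqTp (fun a : A => (a : N)) (by simp)]
  have key : ∀ z : α → N, EqTp L (Sum.elim (fun a : A => f a) (f ∘ z))
      (Sum.elim (fun a : A => (a : N)) z) := fun z => by
    have := eqTp_embedding f (Sum.elim (fun a : A => (a : N)) z)
    rwa [Sum.comp_elim] at this
  exact ⟨fun h => (key x).symm.trans (h.trans (key y)),
    fun h => (key x).trans (h.trans (key y).symm)⟩

/-- Only finitely many entries of `z` occur in `φ`, and these can be quantified away; the other
entries of `t` are arbitrary. -/
theorem EqTp.exists_realize [Nonempty N] {x : γ → N} {y : γ → N'} (h : EqTp L x y) {z : α → N'}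
    {φ : L.Formula (γ ⊕ α)} (hφ : φ.Realize (Sum.elim y z)) :
    ∃ t : α → N, φ.Realize (Sum.elim x t) := by
  classical
  let S : Finset α := φ.freeVarFinset.toRight
  let e : φ.freeVarFinset → γ ⊕ S := fun i => match i with
    | ⟨Sum.inl c, _⟩ => Sum.inl c
    | ⟨Sum.inr a, ha⟩ => Sum.inr ⟨a, by simpa [S] using ha⟩
  let ψ : L.Formula (γ ⊕ S) := BoundedFormula.restrictFreeVar φ e
  have hψ : (ψ.iExs S).Realize y := by
    rw [Formula.realize_iExs]
    refine ⟨fun a => z a, ?_⟩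
    refine (BoundedFormula.realize_restrictFreeVar (φ := φ) (f := e) (Sum.elim y z) ?_).2 hφ
    rintro ⟨c | a, ha⟩ <;> rfl
  obtain ⟨t, ht⟩ := (Formula.realize_iExs.1 ((h _).2 hψ))
  have t₀ : N := Classical.arbitrary N
  refine ⟨fun a => if ha : a ∈ S then t ⟨a, ha⟩ else t₀, ?_⟩
  refine (BoundedFormula.realize_restrictFreeVar (φ := φ) (f := e) _ ?_).1 ht
  rintro ⟨c | a, ha⟩
  · rfl
  · have : a ∈ S := by simpa [S] using ha
    simp [e, this]

end EqTp

/-! ### Compactness, extension of types and amalgamation. -/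

section Compactness

open FirstOrder.Language FirstOrder.Language.Theory

variable {L : FirstOrder.Language.{u, v}} {T : L.Theory}

/-- A set of formulas with parameters in a model `N` which is finitely satisfiable in `N` is
realized in an elementary extension of `N`. -/
theorem exists_realize_of_finitely_satisfiable (N : ModelType.{u, v, max u v} T)
    {α : Type (max u v)} (Γ : Set (L.Formula (N ⊕ α)))
    (h : ∀ q ⊆ Γ, q.Finite → ∃ x : α → N, ∀ φ ∈ q, φ.Realize (Sum.elim id x)) :
    ∃ (N' : ModelType.{u, v, max u v} T) (f : N ↪ₑ[L] N') (x : α → N'),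
      ∀ φ ∈ Γ, φ.Realize (Sum.elim f x) := by
  classical
  -- The elementary diagram of `N`; it makes the model obtained below an elementary extension.
  let Δ : Set (L.Formula (N ⊕ α)) := {φ | ∃ ψ : L.Formula N, ψ.Realize id ∧ φ = ψ.relabel Sum.inl}
  let T' : L[[N ⊕ α]].Theory := Formula.equivSentence '' (Γ ∪ Δ)
  have hT' : T'.IsSatisfiable := by
    rw [isSatisfiable_iff_isFinitelySatisfiable]
    intro T₀ hT₀
    obtain ⟨q, hq, hqT⟩ : ∃ q : Finset (L.Formula (N ⊕ α)), ↑q ⊆ Γ ∪ Δ ∧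
        q.image Formula.equivSentence = T₀ := Finset.subset_set_image_iff.1 hT₀
    obtain ⟨x, hx⟩ := h (↑q ∩ Γ) Set.inter_subset_right (q.finite_toSet.inter_of_left _)
    let : (constantsOn (N ⊕ α)).Structure N := constantsOn.structure (Sum.elim id x)
    refine @Model.isSatisfiable _ _ N _ _ ?_
    rw [← hqT]
    refine ⟨fun σ hσ => ?_⟩
    obtain ⟨φ, hφ, rfl⟩ := Finset.mem_image.1 hσ
    rw [Formula.realize_equivSentence]
    have hcon : (fun a => ((L.con a : L[[N ⊕ α]].Constants) : N)) = Sum.elim id x := rfl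
    rw [hcon]
    rcases hq hφ with h' | ⟨ψ, hψ, rfl⟩
    · exact hx _ ⟨hφ, h'⟩
    · rw [Formula.realize_relabel]
      exact hψ
  obtain ⟨M⟩ := hT'
  let : L.Structure M := (L.lhomWithConstants (N ⊕ α)).reduct M
  have : (L.lhomWithConstants (N ⊕ α)).IsExpansionOn M := LHom.isExpansionOn_reduct _ _
  let c : N ⊕ α → M := fun a => ((L.con a : L[[N ⊕ α]].Constants) : M)
  have hc : ∀ φ ∈ Γ ∪ Δ, φ.Realize c := fun φ hφ => by
    have : (Formula.equivSentence φ).Realize M :=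
      realize_sentence_of_mem T' (Set.mem_image_of_mem _ hφ)
    rwa [Formula.realize_equivSentence] at this
  have he : EqTp L (c ∘ Sum.inl) (id : N → N) := by
    have h1 : ∀ ψ : L.Formula N, ψ.Realize id → ψ.Realize (c ∘ Sum.inl) := fun ψ hψ => by
      have := hc (ψ.relabel Sum.inl) (Or.inr ⟨ψ, hψ, rfl⟩)
      rwa [Formula.realize_relabel] at this
    intro ψ
    refine ⟨fun h2 => ?_, h1 ψ⟩
    by_contra h3
    exact (Formula.realize_not.1 (h1 ψ.not (Formula.realize_not.2 h3))) h2
  obtain ⟨f, hf⟩ := he.exists_embedding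
  have : M ⊨ T := (f.theory_model_iff T).1 inferInstance
  refine ⟨ModelType.of T M, f, c ∘ Sum.inr, fun φ hφ => ?_⟩
  have : Sum.elim (f : N → M) (c ∘ Sum.inr) = c := by
    ext (a | a)
    · exact hf a
    · rfl
  change φ.Realize (Sum.elim (f : N → M) (c ∘ Sum.inr))
  rw [this]
  exact hc φ (Or.inl hφ)

/-- The substitute for homogeneity of the universal domain: the type of `z` over `y` is copied to a
type over `x`, which is finitely satisfiable because `x` and `y` have the same type. -/
theorem EqTp.exists_extension {N N₁ : ModelType.{u, v, max u v} T} {γ : Type*}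
    {α : Type (max u v)} {x : γ → N} {y : γ → N₁} (h : EqTp L x y) (z : α → N₁) :
    ∃ (N' : ModelType.{u, v, max u v} T) (f : N ↪ₑ[L] N') (t : α → N'),
      EqTp L (Sum.elim (f ∘ x) t) (Sum.elim y z) := by
  classical
  obtain ⟨N', f, t, ht⟩ := exists_realize_of_finitely_satisfiable N
    {φ : L.Formula (N ⊕ α) | ∃ ψ : L.Formula (γ ⊕ α), ψ.Realize (Sum.elim y z) ∧
      φ = ψ.relabel (Sum.map x id)} (by
    intro q hq hfin
    have hq' : ∀ φ ∈ q, ∃ ψ : L.Formula (γ ⊕ α), ψ.Realize (Sum.elim y z) ∧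
      φ = ψ.relabel (Sum.map x id) := hq
    choose! ψ hψ using hq'
    have : Finite q := hfin
    let χ : L.Formula (γ ⊕ α) := Formula.iInf fun φ : q => ψ φ
    have hχ : χ.Realize (Sum.elim y z) := Formula.realize_iInf.2 fun φ => (hψ φ φ.2).1
    obtain ⟨t, ht⟩ := h.exists_realize hχ
    refine ⟨t, fun φ hφ => ?_⟩
    rw [(hψ φ hφ).2, Formula.realize_relabel, Sum.elim_comp_map]
    exact Formula.realize_iInf.1 ht ⟨φ, hφ⟩)
  have h1 : ∀ ψ : L.Formula (γ ⊕ α), ψ.Realize (Sum.elim y z) →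
      ψ.Realize (Sum.elim (f ∘ x) t) := fun ψ hψ => by
    have := ht _ ⟨ψ, hψ, rfl⟩
    rwa [Formula.realize_relabel, Sum.elim_comp_map] at this
  refine ⟨N', f, t, fun ψ => ⟨fun h2 => ?_, h1 ψ⟩⟩
  by_contra h3
  exact (Formula.realize_not.1 (h1 ψ.not (Formula.realize_not.2 h3))) h2

/-- Finitely many elementary extensions of a model can be amalgamated. -/
theorem exists_amalgam {N : ModelType.{u, v, max u v} T} :
    ∀ {r : ℕ} (N₁ : Fin r → ModelType.{u, v, max u v} T) (f : ∀ i, N ↪ₑ[L] N₁ i),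
      ∃ (N' : ModelType.{u, v, max u v} T) (F : N ↪ₑ[L] N') (g : ∀ i, N₁ i ↪ₑ[L] N'),
        ∀ i x, g i (f i x) = F x
  | 0, _, _ => ⟨N, ElementaryEmbedding.refl L N, fun i => i.elim0, fun i => i.elim0⟩
  | r + 1, N₁, f => by
    obtain ⟨N', F, g, hg⟩ := exists_amalgam (fun i : Fin r => N₁ i.castSucc) fun i => f i.castSucc
    have h : EqTp L (F : N → N') (f (Fin.last r) : N → N₁ (Fin.last r)) :=
      (eqTp_embedding F id).trans (eqTp_embedding (f (Fin.last r)) id).symm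
    obtain ⟨N'', G, t, ht⟩ := h.exists_extension (id : N₁ (Fin.last r) → N₁ (Fin.last r))
    obtain ⟨k, hk⟩ := EqTp.exists_embedding
      (ht.of_comp Sum.inr (x' := t) (y' := id) (fun _ => rfl) fun _ => rfl)
    refine ⟨N'', G.comp F, Fin.lastCases k fun i => G.comp (g i), fun i x => ?_⟩
    refine Fin.lastCases ?_ (fun i => ?_) i
    · have := (ht.eq_iff (Sum.inl x) (Sum.inr (f (Fin.last r) x))).2 rfl
      simp only [Sum.elim_inl, Sum.elim_inr] at this
      simp [hk, ← this]
    · simp [hg]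

end Compactness

/-! ### A common form for the three kinds of indiscernible structures. -/

section Config

open FirstOrder.Language FirstOrder.Language.Theory

variable {L : FirstOrder.Language.{u, v}}

/-- The tuple of all members of an indexed structure whose index lies in `f`. -/
def configFam {N I J κ Y : Type*} [LinearOrder I] [LinearOrder J] {len : Y → ℕ} (a : I → κ → N)
    (b : ∀ y, (Fin (len y) ↪o I) → N) (f : J ↪o I) :
    (J × κ) ⊕ (Σ y, Fin (len y) ↪o J) → N :=
  Sum.elim (fun x => a (f x.1) x.2) fun x => b x.1 (x.2.trans f)

/-- The restriction on the tuples attached to finite increasing sequences, by kind of dividing: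
there are none for the first kind, and they consist of members of the sequence for the second. -/
def Admissible {N I κ Y : Type*} [LinearOrder I] {len : Y → ℕ} (ℓ : IctKind) (a : I → κ → N)
    (b : ∀ y, (Fin (len y) ↪o I) → N) : Prop :=
  match ℓ with
  | .one => IsEmpty Y
  | .two => ∀ y, ∃ (j : Fin (len y)) (z : κ), ∀ η, b y η = a (η j) z
  | .three => True

/-- An indiscernible structure over `A`, indexed by a linear order and its finite increasing
sequences; the coordinates attached to sequences are listed one by one, each with the length of
the sequences which it is attached to. -/
structure Config (L : FirstOrder.Language.{u, v}) (ℓ : IctKind) {N : Type*} [L.Structure N]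
    (A : Set N) (I : Type*) [LinearOrder I] where
  κ : Type
  Y : Type
  finite_κ : Finite κ
  finite_Y : Finite Y
  len : Y → ℕ
  a : I → κ → N
  b : ∀ y, (Fin (len y) ↪o I) → N
  indisc : ∀ (r : ℕ) (f g : Fin r ↪o I), SameType L A (configFam a b f) (configFam a b g)
  adm : Admissible ℓ a b

variable {ℓ : IctKind} {N N' : Type*} [L.Structure N] [L.Structure N'] {A : Set N}
  {I J : Type*} [LinearOrder I] [LinearOrder J]

namespace Config

/-- The image of a configuration under an elementary embedding. -/
def map (S : Config L ℓ A I) (g : N ↪ₑ[L] N') : Config L ℓ (g '' A) I where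
  κ := S.κ
  Y := S.Y
  finite_κ := S.finite_κ
  finite_Y := S.finite_Y
  len := S.len
  a := fun t z => g (S.a t z)
  b := fun y η => g (S.b y η)
  indisc := fun r f f' => by
    have := (sameType_image g _ _).2 (S.indisc r f f')
    refine this.comp id ?_ ?_ <;> rintro (x | x) <;> rfl
  adm := by
    have h := S.adm
    cases ℓ with
    | one => exact h
    | two =>
      intro y
      obtain ⟨j, z, hz⟩ := h y
      exact ⟨j, z, fun η => congrArg g (hz η)⟩
    | three => trivial

/-- The members attached to the sequence `⟨s 0, …, s (i - 1)⟩`. -/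
def params (S : Config L ℓ A I) (s : ℕ → I) (i : ℕ) : Set N :=
  {x | ∃ y, S.len y = i ∧ ∃ η : Fin (S.len y) ↪o I, (∀ j, η j = s j) ∧ x = S.b y η}

/-- The tuple `c` distinguishes the `s i`-th and the `t i`-th tuples of the sequence over `A` and
the members attached to `⟨s 0, …, s (i - 1)⟩`. -/
def Differs (S : Config L ℓ A I) (g : N → N') {μ : Type} (c : μ → N') (s t : ℕ → I) (i : ℕ) :
    Prop :=
  ¬ SameType L (g '' (A ∪ S.params s i)) (Sum.elim c (g ∘ S.a (s i))) (Sum.elim c (g ∘ S.a (t i)))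

end Config

/-- `s 0 < t 0 ≤ s 1 < … ≤ s (n - 1) < t (n - 1)`. -/
def IsInterlaced (n : ℕ) (s t : ℕ → I) : Prop :=
  (∀ i < n, s i < t i) ∧ ∀ i j, i < j → j < n → t i ≤ s j

theorem IsInterlaced.lt {n : ℕ} {s t : ℕ → I} (h : IsInterlaced n s t) {i j : ℕ} (hij : i < j)
    (hj : j < n) : s i < s j :=
  (h.1 i (hij.trans hj)).trans_le (h.2 i j hij hj)

end Config

/-! ### Translation between dividing and configurations. -/

section Dividing

open FirstOrder.Language FirstOrder.Language.Theory

variable {L : FirstOrder.Language.{u, v}} {T : L.Theory} {ℓ : IctKind} {n : ℕ}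
  {N : ModelType.{u, v, max u v} T} {A : Set N} {B : Set N} {m : ℕ}
  {p : Set (L.Formula (B ⊕ Fin m))}

theorem IctDivides.exists_config (h : IctDivides ℓ n A p) :
    ∃ (N' : ModelType.{u, v, max u v} T) (f : N ↪ₑ[L] N') (I : Type (max u v)) (_ : LinearOrder I)
      (_ : Infinite I) (S : Config L ℓ (f '' A) I) (s t : ℕ → I),
      IsInterlaced n s t ∧
        ∀ (N'' : ModelType.{u, v, max u v} T) (g : N' ↪ₑ[L] N'') (c : Fin m → N''),
          Realizes (g ∘ f) p c → ∀ i < n, S.Differs g c s t i := by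
  -- Beyond `n` the sequences continue with an arbitrary value, which no condition concerns.
  have ext : ∀ {I : Type (max u v)} [LinearOrder I] [Infinite I] {s : Fin n ↪o I} {t : Fin n → I},
      Interlaced s t → ∃ s' t' : ℕ → I, IsInterlaced n s' t' ∧ (∀ i : Fin n, s' i = s i) ∧
        ∀ i : Fin n, t' i = t i := by
    intro I _ _ s t hst
    have x₀ : I := Classical.arbitrary I
    refine ⟨fun i => if h : i < n then s ⟨i, h⟩ else x₀, fun i => if h : i < n then t ⟨i, h⟩ else x₀,
      ⟨fun i hi => ?_, fun i j hij hj => ?_⟩, fun i => ?_, fun i => ?_⟩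
    · simpa [hi] using hst.1 ⟨i, hi⟩
    · simpa [hj, hij.trans hj] using hst.2 ⟨i, hij.trans hj⟩ ⟨j, hj⟩ hij
    · simp
    · simp
  cases ℓ with
  | one =>
    obtain ⟨N', f, I, _, _, k, a, s, t, ha, hst, hd⟩ := h
    obtain ⟨s', t', hst', hs, ht⟩ := ext hst
    refine ⟨N', f, I, _, ‹_›, ⟨Fin k, Empty, inferInstance, inferInstance, Empty.elim, a,
      fun y => y.elim, fun r e e' => ?_, inferInstanceAs (IsEmpty Empty)⟩, s', t', hst', ?_⟩
    · refine (ha r e e').comp (Sum.elim id fun x => x.1.elim) ?_ ?_ <;> rintro (x | x)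
      exacts [rfl, x.1.elim, rfl, x.1.elim]
    · intro N'' g c hc i hi hsame
      refine hd N'' g c hc ⟨i, hi⟩ ?_
      have := hsame.mono (A := (g ∘ f) '' A) (by
        rw [Set.image_comp]; exact Set.image_mono Set.subset_union_left)
      simpa only [hs ⟨i, hi⟩, ht ⟨i, hi⟩] using this
  | two =>
    obtain ⟨N', f, I, _, _, k, a, s, t, ha, hst, hd⟩ := h
    obtain ⟨s', t', hst', hs, ht⟩ := ext hst
    -- All coordinates of all tuples indexed by members of a sequence are attached to that sequence,
    -- so that the parameters `a (s j)`, `j < i`, become those attached to `⟨s 0, …, s (i - 1)⟩`.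
    refine ⟨N', f, I, _, ‹_›, ⟨Fin k, Σ i : Fin n, Fin (i : ℕ) × Fin k, inferInstance,
      inferInstance, fun y => y.1, a, fun y η => a (η y.2.1) y.2.2, fun r e e' => ?_,
      fun y => ⟨y.2.1, y.2.2, fun η => rfl⟩⟩, s', t', hst', ?_⟩
    · refine (ha r e e').comp (Sum.elim id fun x => (x.2 x.1.2.1, x.1.2.2)) ?_ ?_ <;>
        rintro (x | x) <;> rfl
    · intro N'' g c hc i hi hsame
      refine hd N'' g c hc ⟨i, hi⟩ ?_
      have := hsame.mono (A := (g ∘ f) '' A ∪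
          {y | ∃ j, j < (⟨i, hi⟩ : Fin n) ∧ y ∈ Set.range (g ∘ a (s j))}) (by
        rintro x (⟨y, hy, rfl⟩ | ⟨j, hj, z, rfl⟩)
        · exact ⟨f y, Or.inl ⟨y, hy, rfl⟩, rfl⟩
        · have hji : (j : ℕ) < i := hj
          refine ⟨a (s j) z, Or.inr ⟨⟨⟨i, hi⟩, ⟨j, hji⟩, z⟩, rfl,
            initialSeg s ⟨i, hi⟩, fun l => ?_, rfl⟩, rfl⟩
          rw [show (l : ℕ) = ((Fin.castLEOrderEmb hi.le l : Fin n) : ℕ) from rfl, hs]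
          rfl)
      simpa only [hs ⟨i, hi⟩, ht ⟨i, hi⟩] using this
  | three =>
    obtain ⟨N', f, I, _, _, k, a, k', b, s, t, ha, hst, hd⟩ := h
    obtain ⟨s', t', hst', hs, ht⟩ := ext hst
    refine ⟨N', f, I, _, ‹_›, ⟨Fin k, Σ i : Fin n, Fin (k' i), inferInstance,
      inferInstance, fun y => y.1, a, fun y η => b y.1 η y.2, fun r e e' => ?_,
      trivial⟩, s', t', hst', ?_⟩
    · refine (ha r e e').comp (Sum.map id fun x => ⟨x.1.1, x.2, x.1.2⟩) ?_ ?_ <;>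
        rintro (x | x) <;> rfl
    · intro N'' g c hc i hi hsame
      refine hd N'' g c hc ⟨i, hi⟩ ?_
      have := hsame.mono (A := (g ∘ f) '' A ∪
          Set.range (g ∘ b ⟨i, hi⟩ (initialSeg s ⟨i, hi⟩))) (by
        rintro x (⟨y, hy, rfl⟩ | ⟨z, rfl⟩)
        · exact ⟨f y, Or.inl ⟨y, hy, rfl⟩, rfl⟩
        · refine ⟨b ⟨i, hi⟩ (initialSeg s ⟨i, hi⟩) z, Or.inr ⟨⟨⟨i, hi⟩, z⟩, rfl,
            initialSeg s ⟨i, hi⟩, fun l => ?_, rfl⟩, rfl⟩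
          rw [show (l : ℕ) = ((Fin.castLEOrderEmb hi.le l : Fin n) : ℕ) from rfl, hs]
          rfl)
      simpa only [hs ⟨i, hi⟩, ht ⟨i, hi⟩] using this

theorem Config.ictDivides {N' : ModelType.{u, v, max u v} T} {f : N ↪ₑ[L] N'}
    (S : Config L ℓ (f '' A) ℕ) {s t : ℕ → ℕ} (hst : IsInterlaced n s t)
    (h : ∀ (N'' : ModelType.{u, v, max u v} T) (g : N' ↪ₑ[L] N'') (c : Fin m → N''),
      Realizes (g ∘ f) p c → ∀ i < n, S.Differs g c s t i) : IctDivides ℓ n A p := by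
  obtain ⟨k, ⟨ek⟩⟩ : ∃ k, Nonempty (S.κ ≃ Fin k) :=
    ⟨_, ⟨@Finite.equivFin _ S.finite_κ⟩⟩
  let d : ULift.{max u v} ℕ ↪o ℕ := OrderEmbedding.ofStrictMono ULift.down fun _ _ h => h
  let a : ULift.{max u v} ℕ → Fin k → N' := fun t z => S.a t.down (ek.symm z)
  let s' : Fin n ↪o ULift.{max u v} ℕ := OrderEmbedding.ofStrictMono (fun i => ⟨s i⟩)
    fun i j hij => hst.lt hij j.2
  let t' : Fin n → ULift.{max u v} ℕ := fun i => ⟨t i⟩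
  have hst' : Interlaced s' t' :=
    ⟨fun i => hst.1 i i.2, fun i j hij => hst.2 i j hij j.2⟩
  have key : ∀ (N'' : ModelType.{u, v, max u v} T) (g : N' ↪ₑ[L] N'') (c : Fin m → N''),
      Realizes (g ∘ f) p c → ∀ i : Fin n, ∀ D : Set N'', (g ∘ f) '' A ⊆ D →
      g '' S.params s i ⊆ D →
        ¬ SameType L D (Sum.elim c (g ∘ a (s' i))) (Sum.elim c (g ∘ a (t' i))) := by
    intro N'' g c hc i D hA hD hsame
    refine h N'' g c hc i i.2 ?_
    refine (hsame.mono (A := g '' (f '' A ∪ S.params s i)) ?_).comp (Sum.map id ek) ?_ ?_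
    · rw [Set.image_union, ← Set.image_comp]
      exact Set.union_subset hA hD
    · rintro (x | x)
      · rfl
      · simp only [Sum.elim_inr, Sum.map_inr, Function.comp_apply, a, Equiv.symm_apply_apply]
        rfl
    · rintro (x | x) <;> simp [a, t']
  cases ℓ with
  | one =>
    have hY : IsEmpty S.Y := S.adm
    refine ⟨N', f, ULift ℕ, _, inferInstance, k, a, s', t', fun r e e' => ?_, hst', ?_⟩
    · refine (S.indisc r (e.trans d) (e'.trans d)).comp
        (fun x => Sum.inl (x.1, ek.symm x.2)) ?_ ?_ <;> intro x <;> rfl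
    · intro N'' g c hc i
      refine key N'' g c hc i _ subset_rfl ?_
      rintro _ ⟨x, ⟨y, -⟩, rfl⟩
      exact hY.elim y
  | two =>
    refine ⟨N', f, ULift ℕ, _, inferInstance, k, a, s', t', fun r e e' => ?_, hst', ?_⟩
    · refine (S.indisc r (e.trans d) (e'.trans d)).comp
        (fun x => Sum.inl (x.1, ek.symm x.2)) ?_ ?_ <;> intro x <;> rfl
    · intro N'' g c hc i
      refine key N'' g c hc i _ Set.subset_union_left ?_
      rintro _ ⟨x, ⟨y, hy, η, hη, rfl⟩, rfl⟩
      obtain ⟨j, z, hz⟩ := S.adm y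
      have hj : (j : ℕ) < i := hy ▸ j.2
      refine Or.inr ⟨⟨j, hj.trans i.2⟩, hj, ek z, ?_⟩
      simp only [Function.comp_apply, a, hz, hη, Equiv.symm_apply_apply]
      rfl
  | three =>
    have fin : ∀ i : Fin n, Finite {y // S.len y = i} := fun i => by
      have := S.finite_Y
      infer_instance
    choose k' ek' using fun i : Fin n => (⟨_, ⟨@Finite.equivFin _ (fin i)⟩⟩ :
      ∃ k', Nonempty ({y // S.len y = i} ≃ Fin k'))
    let ek'' := fun i => (ek' i).some
    -- Coordinates attached to sequences of the same length are gathered into one tuple; lengths `≥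
    -- n` play no role.
    let b : ∀ i : Fin n, (Fin (i : ℕ) ↪o ULift.{max u v} ℕ) → Fin (k' i) → N' := fun i η z =>
      S.b ((ek'' i).symm z).1
        ((Fin.castOrderIso ((ek'' i).symm z).2).toOrderEmbedding.trans (η.trans d))
    refine ⟨N', f, ULift ℕ, _, inferInstance, k, a, k', b, s', t', fun r e e' => ?_, hst', ?_⟩
    · refine (S.indisc r (e.trans d) (e'.trans d)).comp
        (Sum.map (fun x => (x.1, ek.symm x.2)) fun x => ⟨((ek'' x.1).symm x.2.2).1,
          (Fin.castOrderIso ((ek'' x.1).symm x.2.2).2).toOrderEmbedding.trans x.2.1⟩) ?_ ?_ <;>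
        rintro (x | x) <;> rfl
    · intro N'' g c hc i
      refine key N'' g c hc i _ Set.subset_union_left ?_
      rintro _ ⟨x, ⟨y, hy, η, hη, rfl⟩, rfl⟩
      refine Or.inr ⟨ek'' i ⟨y, hy⟩, ?_⟩
      simp only [Function.comp_apply, b]
      have : ∀ (y' : {y // S.len y = i}) (hy' : y' = ⟨y, hy⟩),
          S.b y'.1 ((Fin.castOrderIso y'.2).toOrderEmbedding.trans
            ((initialSeg s' i).trans d)) = S.b y η := by
        rintro _ rfl
        congr 1
        ext j
        rw [hη]
        rfl
      rw [this _ ((ek'' i).symm_apply_apply _)]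

end Dividing

/-! ### Reindexing configurations by the natural numbers, with large gaps. -/

section Stretch

open FirstOrder.Language FirstOrder.Language.Theory

variable {L : FirstOrder.Language.{u, v}} {T : L.Theory}

/-- The indices of members of a configuration over `J` transported along `e : J ↪o I`. -/
def liftIdx {I J κ Y : Type*} [LinearOrder I] [LinearOrder J] {len : Y → ℕ} (e : J ↪o I) :
    (J × κ) ⊕ (Σ y, Fin (len y) ↪o J) → (I × κ) ⊕ (Σ y, Fin (len y) ↪o I) :=
  Sum.map (fun x => (e x.1, x.2)) fun x => ⟨x.1, x.2.trans e⟩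

theorem exists_orderEmbedding_fin (I : Type*) [LinearOrder I] [Infinite I] (R : ℕ) :
    Nonempty (Fin R ↪o I) := by
  obtain ⟨s, hs⟩ := Infinite.exists_subset_card_eq I R
  exact ⟨s.orderEmbOfFin hs⟩

namespace Config

variable {ℓ : IctKind}

/-- A configuration over an infinite linear order has a configuration over `ℕ` of the same type in
some elementary extension. -/
theorem exists_nat_fam {N : ModelType.{u, v, max u v} T} {A : Set N} {I : Type*} [LinearOrder I]
    [Infinite I] (S : Config L ℓ A I) :
    ∃ (N' : ModelType.{u, v, max u v} T) (f : N ↪ₑ[L] N')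
      (w : (ℕ × S.κ) ⊕ (Σ y, Fin (S.len y) ↪o ℕ) → N'),
      ∀ (r : ℕ) (e : Fin r ↪o ℕ) (h : Fin r ↪o I),
        EqTp L (Sum.elim (fun x : A => f x) (w ∘ liftIdx e))
          (Sum.elim (fun x : A => (x : N)) (configFam S.a S.b h)) := by
  classical
  let W := (ℕ × S.κ) ⊕ (Σ y, Fin (S.len y) ↪o ℕ)
  let V : ℕ → Type := fun r => (Fin r × S.κ) ⊕ (Σ y, Fin (S.len y) ↪o Fin r)
  let lf : ∀ {r : ℕ}, (Fin r ↪o ℕ) → A ⊕ V r → N ⊕ ULift.{max u v} W := fun e =>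
    Sum.map Subtype.val fun x => ULift.up (liftIdx e x)
  obtain ⟨N', f, t, ht⟩ := exists_realize_of_finitely_satisfiable N
    {φ : L.Formula (N ⊕ ULift.{max u v} W) | ∃ (r : ℕ) (e : Fin r ↪o ℕ) (ψ : L.Formula (A ⊕ V r)),
      (∀ h : Fin r ↪o I, ψ.Realize (Sum.elim (fun x : A => (x : N)) (configFam S.a S.b h))) ∧
        φ = ψ.relabel (lf e)} (by
    intro q hq hfin
    have hq' : ∀ φ : q, ∃ (r : ℕ) (e : Fin r ↪o ℕ) (ψ : L.Formula (A ⊕ V r)),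
      (∀ h : Fin r ↪o I, ψ.Realize (Sum.elim (fun x : A => (x : N)) (configFam S.a S.b h))) ∧
        φ.1 = ψ.relabel (lf e) := fun φ => hq φ.2
    choose r e ψ hψ using hq'
    have : Finite q := hfin
    obtain ⟨R, hR⟩ : ∃ R, ∀ (φ : q) (i : Fin (r φ)), e φ i < R := by
      obtain ⟨R, hR⟩ := (Set.finite_range fun x : Σ φ : q, Fin (r φ) => e x.1 x.2).bddAbove
      exact ⟨R + 1, fun φ i => Nat.lt_succ_of_le (hR ⟨⟨φ, i⟩, rfl⟩)⟩
    obtain ⟨h⟩ := exists_orderEmbedding_fin I R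
    have x₀ : N := Classical.arbitrary N
    -- Indices below `R` are interpreted along `Fin R ↪o I`; the value `x₀` fills the places which
    -- no formula of `q` mentions.
    let x : W → N := Sum.elim
      (fun y => if hy : y.1 < R then S.a (h ⟨y.1, hy⟩) y.2 else x₀)
      (fun y => if hy : ∀ j, y.2 j < R then S.b y.1 ((OrderEmbedding.ofStrictMono
        (fun j => (⟨y.2 j, hy j⟩ : Fin R)) fun i j hij => y.2.strictMono hij).trans h) else x₀)
    refine ⟨x ∘ ULift.down, fun φ hφ => ?_⟩
    let φ' : q := ⟨φ, hφ⟩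
    rw [show φ = φ'.1 from rfl, (hψ φ').2, Formula.realize_relabel]
    let d : Fin (r φ') ↪o Fin R := OrderEmbedding.ofStrictMono (fun i => ⟨e φ' i, hR φ' i⟩)
      fun i j hij => (e φ').strictMono hij
    convert (hψ φ').1 (d.trans h) using 1
    funext y
    rcases y with y | ⟨i, z⟩ | ⟨y, η⟩
    · rfl
    · exact dif_pos (hR φ' i)
    · exact dif_pos fun j => hR φ' (η j))
  let w : W → N' := fun y => t ⟨y⟩
  have key : ∀ (r : ℕ) (e : Fin r ↪o ℕ) (h : Fin r ↪o I) (ψ : L.Formula (A ⊕ V r)),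
      ψ.Realize (Sum.elim (fun x : A => (x : N)) (configFam S.a S.b h)) →
        ψ.Realize (Sum.elim (fun x : A => f x) (w ∘ liftIdx e)) := by
    intro r e h ψ hψ
    have := ht _ ⟨r, e, ψ, fun h' => (S.indisc r h h' ψ).1 hψ, rfl⟩
    rw [Formula.realize_relabel] at this
    convert this using 1
    funext y
    rcases y with y | y <;> rfl
  refine ⟨N', f, w, fun r e h ψ => ⟨fun h2 => ?_, key r e h ψ⟩⟩
  by_contra h3
  exact (Formula.realize_not.1 (key r e h ψ.not (Formula.realize_not.2 h3))) h2

/-- A configuration can be spread out, so that the distinguished indices become natural numbers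
with large gaps. -/
theorem exists_stretch {N : ModelType.{u, v, max u v} T} {A : Set N} {I : Type*} [LinearOrder I]
    [Infinite I] (S : Config L ℓ A I) {n : ℕ} {s t : ℕ → I} (hst : IsInterlaced n s t) {M : ℕ}
    (hM : 2 ≤ M) :
    ∃ (N' : ModelType.{u, v, max u v} T) (f : N ↪ₑ[L] N') (S' : Config L ℓ (f '' A) ℕ)
      (t' : ℕ → ℕ), (∀ i, t' i = M * i + 1 ∨ t' i = M * (i + 1)) ∧
      ∀ (N'' : ModelType.{u, v, max u v} T) (g : N' ↪ₑ[L] N'') (μ : Type) (c : μ → N''),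
        ∀ i < n, S.Differs (g ∘ f) c s t i → S'.Differs g c (fun j => M * j) t' i := by
  classical
  obtain ⟨N₁, f₁, w, hw⟩ := S.exists_nat_fam
  -- The numbers which stand for given points of `I`: `M * i` for `s i`, and `M * i + 1` for `t i`,
  -- unless `t i = s (i + 1)`, when `M * (i + 1)` already represents `t i`. On this set `σ` is
  -- strictly increasing.
  let G : Finset ℕ := (Finset.range (M * n)).filter fun x =>
    x % M = 0 ∨ (x % M = 1 ∧ (x / M + 1 < n → t (x / M) ≠ s (x / M + 1)))
  let σ : ℕ → I := fun x => if x % M = 0 then s (x / M) else t (x / M)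
  have hσ : ∀ x ∈ G, ∀ y ∈ G, x < y → σ x < σ y := by
    intro x hx y hy hxy
    simp only [G, Finset.mem_filter, Finset.mem_range] at hx hy
    have hyn : y / M < n := Nat.div_lt_of_lt_mul hy.1
    have hsy : s (y / M) ≤ σ y := by
      simp only [σ]
      split_ifs
      · exact le_rfl
      · exact (hst.1 _ hyn).le
    rcases (Nat.div_le_div_right (c := M) hxy.le).eq_or_lt with heq | hlt
    · have hx' := Nat.div_add_mod x M
      have hy' := Nat.div_add_mod y M
      rw [heq] at hx'
      have hx0 : x % M = 0 := by omega
      have hy0 : y % M ≠ 0 := by omega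
      simp only [σ, hx0, hy0, if_true, if_false, heq]
      exact hst.1 _ hyn
    · refine lt_of_lt_of_le ?_ hsy
      simp only [σ]
      split_ifs with h0
      · exact hst.lt hlt hyn
      · have h1 := (hx.2.resolve_left h0).2 (by omega)
        refine lt_of_lt_of_le (lt_of_le_of_ne (hst.2 _ _ (Nat.lt_succ_self _) (by omega)) h1) ?_
        rcases (Nat.succ_le_of_lt hlt).eq_or_lt with h2 | h2
        · exact (congrArg s h2).le
        · exact (hst.lt h2 hyn).le
  let e₀ : Fin G.card ↪o ℕ := G.orderEmbOfFin rfl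
  have he₀ : ∀ k, e₀ k ∈ G := fun k => G.orderEmbOfFin_mem rfl k
  have hG : ∀ x ∈ G, ∃ k, e₀ k = x := fun x hx => by
    have : x ∈ Set.range e₀ := by rw [Finset.range_orderEmbOfFin]; exact hx
    exact this
  let h₀ : Fin G.card ↪o I := OrderEmbedding.ofStrictMono (fun k => σ (e₀ k))
    fun i j hij => hσ _ (he₀ i) _ (he₀ j) (e₀.strictMono hij)
  -- The family over `ℕ` is realized anew in an extension of `N`, with its part indexed by `G` equal
  -- to the image of the given part of `S`. The identification is read off from equations in the
  -- type.
  obtain ⟨N', f, t₁, ht₁⟩ := (hw _ e₀ h₀).symm.exists_extension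
    (fun x : ULift.{max u v} _ => w x.down)
  let a' : ℕ → S.κ → N' := fun x z => t₁ ⟨Sum.inl (x, z)⟩
  let b' : ∀ y, (Fin (S.len y) ↪o ℕ) → N' := fun y η => t₁ ⟨Sum.inr ⟨y, η⟩⟩
  have hfam : ∀ (r : ℕ) (e : Fin r ↪o ℕ) (h : Fin r ↪o I),
      EqTp L (Sum.elim (fun x : A => f x) (configFam a' b' e))
        (Sum.elim (fun x : A => (x : N)) (configFam S.a S.b h)) := by
    intro r e h
    refine EqTp.trans ?_ (hw r e h)
    refine ht₁.of_comp (Sum.elim (fun x => Sum.inl (Sum.inl x)) fun x => Sum.inr ⟨liftIdx e x⟩)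
      ?_ ?_ <;> rintro (x | x | x) <;> rfl
  have hfix : ∀ x, f (configFam S.a S.b h₀ x) = t₁ ⟨liftIdx e₀ x⟩ := fun x =>
    (ht₁.eq_iff (Sum.inl (Sum.inr x)) (Sum.inr ⟨liftIdx e₀ x⟩)).2 rfl
  let t' : ℕ → ℕ := fun i => if i + 1 < n ∧ t i = s (i + 1) then M * (i + 1) else M * i + 1
  have hMi : ∀ i < n, M * i ∈ G := fun i hi => by
    simp only [G, Finset.mem_filter, Finset.mem_range, Nat.mul_mod_right, true_or, and_true]
    exact Nat.mul_lt_mul_of_pos_left hi (by omega)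
  have hσM : ∀ i, σ (M * i) = s i := fun i => by
    simp [σ, Nat.mul_div_cancel_left i (by omega : 0 < M)]
  have h1M : ∀ i, (M * i + 1) % M = 1 := fun i => by
    rw [Nat.mul_add_mod, Nat.mod_eq_of_lt (by omega)]
  have hdM : ∀ i, (M * i + 1) / M = i := fun i => by
    rw [Nat.mul_add_div (by omega), Nat.div_eq_of_lt (by omega), add_zero]
  have ht'G : ∀ i < n, t' i ∈ G ∧ σ (t' i) = t i := by
    intro i hi
    simp only [t']
    split_ifs with h
    · exact ⟨hMi _ h.1, by rw [hσM, h.2]⟩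
    · refine ⟨?_, by simp only [σ, h1M, hdM, one_ne_zero, if_false]⟩
      simp only [G, Finset.mem_filter, Finset.mem_range, h1M, hdM]
      refine ⟨?_, Or.inr ⟨trivial, fun h1 h2 => h ⟨h1, h2⟩⟩⟩
      calc M * i + 1 < M * i + M := by omega
        _ = M * (i + 1) := by ring
        _ ≤ M * n := Nat.mul_le_mul_left _ hi
  have ha : ∀ x ∈ G, ∀ z, f (S.a (σ x) z) = a' x z := by
    intro x hx z
    obtain ⟨k, rfl⟩ := hG x hx
    exact hfix (Sum.inl (k, z))
  refine ⟨N', f, ⟨S.κ, S.Y, S.finite_κ, S.finite_Y, S.len, a', b', ?_, ?_⟩, t', ?_, ?_⟩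
  · intro r e e'
    obtain ⟨h⟩ := exists_orderEmbedding_fin I r
    rw [sameType_iff_eqTp (fun x : A => f x) (by ext; simp)]
    exact (hfam r e h).trans (hfam r e' h).symm
  · have had := S.adm
    cases ℓ with
    | one => exact had
    | two =>
      intro y
      obtain ⟨j, z, hz⟩ := had y
      refine ⟨j, z, fun η => ?_⟩
      obtain ⟨h⟩ := exists_orderEmbedding_fin I (S.len y)
      exact ((hfam _ η h).eq_iff (Sum.inr (Sum.inr ⟨y, RelEmbedding.refl _⟩))
        (Sum.inr (Sum.inl (j, z)))).2 (hz _)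
    | three => trivial
  · intro i
    simp only [t']
    split_ifs
    · exact Or.inr rfl
    · exact Or.inl rfl
  · intro N'' g μ c i hi hd hsame
    refine hd ((hsame.mono (A := (g ∘ f) '' (A ∪ S.params s i)) ?_).comp id ?_ ?_)
    · rw [Set.image_comp]
      refine Set.image_mono ?_
      rw [Set.image_union]
      refine Set.union_subset_union_right _ ?_
      rintro _ ⟨x, ⟨y, hy, η, hη, rfl⟩, rfl⟩
      have hlt : ∀ j : Fin (S.len y), (j : ℕ) < n := fun j =>
        (j.2.trans_eq hy).trans hi
      choose k hk using fun j : Fin (S.len y) => hG _ (hMi j (hlt j))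
      let k' : Fin (S.len y) ↪o Fin G.card := OrderEmbedding.ofStrictMono k fun i j hij => by
        rw [← e₀.lt_iff_lt, hk, hk]
        exact Nat.mul_lt_mul_of_pos_left hij (by omega)
      refine ⟨y, hy, k'.trans e₀, hk, ?_⟩
      have : η = k'.trans h₀ := by
        ext j
        rw [hη]
        change _ = σ (e₀ (k j))
        rw [hk, hσM]
      rw [this]
      exact hfix (Sum.inr ⟨y, k'⟩)
    · rintro (x | x)
      · rfl
      · simp only [Sum.elim_inr, Function.comp_apply, id]
        rw [← ha _ (hMi i hi), hσM]
    · rintro (x | x)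
      · rfl
      · simp only [Sum.elim_inr, Function.comp_apply, id]
        rw [← ha _ (ht'G i hi).1, (ht'G i hi).2]

end Config

end Stretch

/-! ### Forking in terms of distinguished realizations. -/

section Forking

open FirstOrder.Language FirstOrder.Language.Theory

variable {L : FirstOrder.Language.{u, v}} {T : L.Theory} {ℓ : IctKind} {M n : ℕ}

theorem Config.params_map {N N' I : Type*} [L.Structure N] [L.Structure N'] [LinearOrder I]
    {A : Set N} (S : Config L ℓ A I) (h : N ↪ₑ[L] N') (s : ℕ → I) (i : ℕ) :
    (S.map h).params s i = h '' S.params s i := by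
  ext x
  constructor
  · rintro ⟨y, hy, η, hη, rfl⟩
    exact ⟨_, ⟨y, hy, η, hη, rfl⟩, rfl⟩
  · rintro ⟨_, ⟨y, hy, η, hη, rfl⟩, rfl⟩
    exact ⟨y, hy, η, hη, rfl⟩

theorem Config.differs_map {N N' N'' I : Type*} [L.Structure N] [L.Structure N'] [L.Structure N'']
    [LinearOrder I] {A : Set N} (S : Config L ℓ A I) (h : N ↪ₑ[L] N') {μ : Type} (g : N' → N'')
    (c : μ → N'') (s t : ℕ → I) (i : ℕ) :
    (S.map h).Differs g c s t i ↔ S.Differs (g ∘ h) c s t i := by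
  unfold Config.Differs
  rw [S.params_map, ← Set.image_union, Set.image_comp]
  rfl

theorem isInterlaced_mul (hM : 1 ≤ M) {t : ℕ → ℕ}
    (ht : ∀ i, t i = M * i + 1 ∨ t i = M * (i + 1)) (n : ℕ) :
    IsInterlaced n (fun j => M * j) t := by
  refine ⟨fun i _ => ?_, fun i j hij _ => ?_⟩
  · rcases ht i with h | h <;> simp only [h] <;> nlinarith
  · have := Nat.mul_le_mul_left M (Nat.succ_le_of_lt hij)
    rw [Nat.succ_eq_add_one, Nat.mul_add, mul_one] at this
    rcases ht i with h | h <;> simp only [h, Nat.mul_add, mul_one] <;> omega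

/-- Some configuration over `A` in `N` has `n` pairs of tuples, at distance at most `M`, which are
distinguished by `c`. -/
def IsDistinguished (L : FirstOrder.Language.{u, v}) (ℓ : IctKind) (M n : ℕ) {N N' : Type*}
    [L.Structure N] [L.Structure N'] (A : Set N) (g : N → N') {μ : Type} (c : μ → N') : Prop :=
  ∃ (S : Config L ℓ A ℕ) (t : ℕ → ℕ), (∀ i, t i = M * i + 1 ∨ t i = M * (i + 1)) ∧
    ∀ i < n, S.Differs g c (fun j => M * j) t i

theorem IsDistinguished.comp_equiv {N N' : Type*}
    [L.Structure N] [L.Structure N'] {A : Set N} {g : N → N'} {μ ν : Type} {c : μ → N'}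
    (h : IsDistinguished L ℓ M n A g c) (e : ν ≃ μ) : IsDistinguished L ℓ M n A g (c ∘ e) := by
  obtain ⟨S, t, ht, hd⟩ := h
  refine ⟨S, t, ht, fun i hi hsame => hd i hi (hsame.comp (Sum.map e.symm id) ?_ ?_)⟩ <;>
    rintro (x | x) <;> simp

/-- Each dividing disjunct comes with a configuration in its own extension. Once stretched to a
common shape, these finitely many configurations are moved into one amalgam; a realization satisfies
some disjunct and is distinguished by the corresponding configuration. -/
theorem IctForks.exists_isDistinguished {N : ModelType.{u, v, max u v} T} {A B : Set N} {m : ℕ}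
    {p : Set (L.Formula (B ⊕ Fin m))} (h : IctForks ℓ n A p) (hM : 2 ≤ M) :
    ∃ (N' : ModelType.{u, v, max u v} T) (f : N ↪ₑ[L] N'),
      ∀ (N'' : ModelType.{u, v, max u v} T) (g : N' ↪ₑ[L] N'') (c : Fin m → N''),
        Realizes (g ∘ f) p c → IsDistinguished L ℓ M n (f '' A) g c := by
  obtain ⟨N', f, C, r, φ, himp, hdiv⟩ := h
  choose N₁ f₁ I hI hinf S s t hst hd using fun i => (hdiv i).exists_config
  choose N₂ f₂ S₂ t₂ ht₂ hd₂ using fun i => (S i).exists_stretch (hst i) hM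
  obtain ⟨N₃, F, k, hk⟩ := exists_amalgam N₂ fun i => (f₂ i).comp (f₁ i)
  refine ⟨N₃, F.comp f, fun N'' g c hc => ?_⟩
  obtain ⟨i, hi⟩ := himp N'' (g.comp F) c hc
  have hA : F.comp f '' A = k i '' (f₂ i '' (f₁ i '' (f '' A))) := by
    simp only [← Set.image_comp]
    refine Set.image_congr fun x _ => (hk i (f x)).symm
  rw [hA]
  refine ⟨(S₂ i).map (k i), t₂ i, ht₂ i, fun j hj => ?_⟩
  rw [Config.differs_map]
  refine hd₂ i N'' (g.comp (k i)) _ c j hj ?_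
  refine hd i N'' ((g.comp (k i)).comp (f₂ i)) c ?_ j hj
  intro ψ hψ
  have := hi ψ hψ
  convert this using 2
  ext x
  exact congrArg g (hk i x)

/-- If `p` did not fork, it would be consistent with the negations of all dividing formulas over
`N'`. A configuration distinguishing a realization of all this yields a single formula over `N'`,
satisfied by the realization, which says that the `n` pairs are distinguished. By the same
configuration this formula divides, a contradiction. -/
theorem ictForks_of_isDistinguished {N : ModelType.{u, v, max u v} T} {A B : Set N} {m : ℕ}
    {p : Set (L.Formula (B ⊕ Fin m))} (hM : 1 ≤ M) {N' : ModelType.{u, v, max u v} T}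
    {f : N ↪ₑ[L] N'}
    (h : ∀ (N'' : ModelType.{u, v, max u v} T) (g : N' ↪ₑ[L] N'') (c : Fin m → N''),
        Realizes (g ∘ f) p c → IsDistinguished L ℓ M n (f '' A) g c) :
    IctForks ℓ n A p := by
  classical
  by_contra hfork
  let ρ : (Set.univ : Set N') ⊕ Fin m → N' ⊕ ULift.{max u v} (Fin m) :=
    Sum.map Subtype.val ULift.up
  let Φ : Set (L.Formula ((Set.univ : Set N') ⊕ Fin m)) := {φ | IctDivides ℓ n (f '' A) {φ}}
  let Γ₁ : Set (L.Formula (N' ⊕ ULift.{max u v} (Fin m))) :=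
    (fun φ : L.Formula (B ⊕ Fin m) =>
      (φ.relabel (Sum.map (fun b : B => f b) ULift.up) :
        L.Formula (N' ⊕ ULift.{max u v} (Fin m)))) '' p
  let Γ₂ : Set (L.Formula (N' ⊕ ULift.{max u v} (Fin m))) :=
    (fun φ : L.Formula ((Set.univ : Set N') ⊕ Fin m) => (φ.relabel ρ).not) '' Φ
  obtain ⟨N'', g, c, hc⟩ := exists_realize_of_finitely_satisfiable N' (Γ₁ ∪ Γ₂) (by
    intro q hq hfin
    have hfin₂ : Finite ↥(q ∩ Γ₂) := hfin.inter_of_left Γ₂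
    obtain ⟨r, ⟨er⟩⟩ : ∃ r, Nonempty (↥(q ∩ Γ₂) ≃ Fin r) := ⟨_, ⟨Finite.equivFin _⟩⟩
    choose φ hφ hφ' using fun x : ↥(q ∩ Γ₂) => x.2.2
    -- Otherwise `p` implies the disjunction of the formulas negated in `q`, and therefore forks.
    have : ∃ (N'' : ModelType.{u, v, max u v} T) (g : N' ↪ₑ[L] N'') (c : Fin m → N''),
        Realizes (g ∘ f) p c ∧ ∀ i, ¬ Realizes g {φ (er.symm i)} c := by
      by_contra hcon
      push Not at hcon
      exact hfork ⟨N', f, Set.univ, r, fun i => φ (er.symm i), hcon, fun i => hφ _⟩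
    obtain ⟨N'', g, c, hc, hn⟩ := this
    have hall : ∀ ψ ∈ q, ψ.Realize (Sum.elim g fun i : ULift.{max u v} (Fin m) => c i.down) := by
      intro ψ hψ
      by_cases h2 : ψ ∈ Γ₂
      · have := hn (er ⟨ψ, hψ, h2⟩)
        rw [Equiv.symm_apply_apply] at this
        have h3 := hφ' ⟨ψ, hψ, h2⟩
        simp only at h3
        rw [← h3, Formula.realize_not, Formula.realize_relabel, Sum.elim_comp_map]
        intro h4
        exact this (by rintro _ rfl; exact h4)
      · obtain ⟨χ, hχ, rfl⟩ := (hq hψ).resolve_right h2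
        rw [Formula.realize_relabel, Sum.elim_comp_map]
        exact hc χ hχ
    have : Finite q := hfin
    obtain ⟨x, hx⟩ := (eqTp_embedding g id).symm.exists_realize
      (φ := Formula.iInf fun ψ : q => ψ.1) (Formula.realize_iInf.2 fun ψ => hall _ ψ.2)
    exact ⟨x, fun ψ hψ => Formula.realize_iInf.1 hx ⟨ψ, hψ⟩⟩)
  have hreal : Realizes (g ∘ f) p fun i => c ⟨i⟩ := by
    intro φ hφ
    have := hc _ (Or.inl ⟨φ, hφ, rfl⟩)
    rwa [Formula.realize_relabel, Sum.elim_comp_map] at this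
  obtain ⟨S, t, ht, hd⟩ := h N'' g _ hreal
  let D : ℕ → Set N' := fun i => f '' A ∪ S.params (fun j => M * j) i
  have hiff : ∀ (N₁ : ModelType.{u, v, max u v} T) (g₁ : N' ↪ₑ[L] N₁) (c₁ : Fin m → N₁) (i : ℕ),
      S.Differs g₁ c₁ (fun j => M * j) t i ↔
        ¬ EqTp L (Sum.elim (fun x : D i => g₁ x) (Sum.elim c₁ (g₁ ∘ S.a (M * i))))
          (Sum.elim (fun x : D i => g₁ x) (Sum.elim c₁ (g₁ ∘ S.a (t i)))) :=
    fun N₁ g₁ c₁ i => not_congr (sameType_iff_eqTp _ (by ext; simp [D]) _ _)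
  have hφ : ∀ i : Fin n, ∃ φ : L.Formula (D i ⊕ (Fin m ⊕ S.κ)),
      ¬ (φ.Realize (Sum.elim (fun x : D i => g x)
          (Sum.elim (fun i => c ⟨i⟩) (g ∘ S.a (M * i)))) ↔
        φ.Realize (Sum.elim (fun x : D i => g x)
          (Sum.elim (fun i => c ⟨i⟩) (g ∘ S.a (t i))))) := by
    intro i
    have := (hiff _ _ _ _).1 (hd i i.2)
    unfold EqTp at this
    push Not at this
    exact this.imp fun φ hφ => by tauto
  choose φ hφ using hφ
  let mv : ∀ (i : Fin n) (x : ℕ), D i ⊕ (Fin m ⊕ S.κ) → (Set.univ : Set N') ⊕ Fin m := fun i x =>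
    Sum.elim (fun d => Sum.inl ⟨d, trivial⟩) (Sum.elim Sum.inr fun z => Sum.inl ⟨S.a x z, trivial⟩)
  -- One formula `φ i` witnesses each difference of types, and `χ` says that every `φ i` separates
  -- its pair.
  let χ : L.Formula ((Set.univ : Set N') ⊕ Fin m) := Formula.iInf fun i : Fin n =>
    (((φ i).relabel (mv i (M * i))).iff ((φ i).relabel (mv i (t i)))).not
  have hmv : ∀ (N₁ : ModelType.{u, v, max u v} T) (g₁ : N' ↪ₑ[L] N₁) (c₁ : Fin m → N₁) (i : Fin n)
      (x : ℕ), Sum.elim (fun b : (Set.univ : Set N') => g₁ b) c₁ ∘ mv i x =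
        Sum.elim (fun x : D i => g₁ x) (Sum.elim c₁ (g₁ ∘ S.a x)) := by
    intro N₁ g₁ c₁ i x
    funext y
    rcases y with y | y | y <;> rfl
  have hχ : ∀ (N₁ : ModelType.{u, v, max u v} T) (g₁ : N' ↪ₑ[L] N₁) (c₁ : Fin m → N₁),
      χ.Realize (Sum.elim (fun b : (Set.univ : Set N') => g₁ b) c₁) ↔ ∀ i : Fin n,
        ¬ ((φ i).Realize (Sum.elim (fun x : D i => g₁ x) (Sum.elim c₁ (g₁ ∘ S.a (M * i)))) ↔
          (φ i).Realize (Sum.elim (fun x : D i => g₁ x) (Sum.elim c₁ (g₁ ∘ S.a (t i))))) := by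
    intro N₁ g₁ c₁
    simp only [χ, Formula.realize_iInf, Formula.realize_not, Formula.realize_iff,
      Formula.realize_relabel, hmv]
  have hdivχ : χ ∈ Φ := by
    refine Config.ictDivides (f := ElementaryEmbedding.refl L N')
      (S.map (ElementaryEmbedding.refl L N')) (isInterlaced_mul hM ht n) ?_
    intro N₁ g₁ c₁ hc₁ i hi
    rw [Config.differs_map]
    refine (hiff N₁ g₁ c₁ i).2 fun heq => ?_
    exact (hχ N₁ g₁ c₁).1 (hc₁ χ rfl) ⟨i, hi⟩ (heq _)
  have h1 := hc _ (Or.inr ⟨χ, hdivχ, rfl⟩)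
  rw [Formula.realize_not, Formula.realize_relabel, Sum.elim_comp_map] at h1
  exact h1 ((hχ N'' g _).2 hφ)

/-- The type of `c₀` over `B` forks over `A`: all its realizations over some elementary extension
are distinguished by a configuration in that extension. -/
def TypeForks (ℓ : IctKind) (M n : ℕ) {N N₀ : ModelType.{u, v, max u v} T} (f₀ : N ↪ₑ[L] N₀)
    (A B : Set N) {μ : Type} (c₀ : μ → N₀) : Prop :=
  ∃ (N' : ModelType.{u, v, max u v} T) (f : N ↪ₑ[L] N'),
    ∀ (N'' : ModelType.{u, v, max u v} T) (g : N' ↪ₑ[L] N'') (c : μ → N''),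
      EqTp L (Sum.elim (fun b : B => g (f b)) c) (Sum.elim (fun b : B => f₀ b) c₀) →
        IsDistinguished L ℓ M n (f '' A) g c

/-- Forking is inherited by stronger types, so `p` may be replaced by the complete type over `B` of
one of its realizations. -/
theorem KappaIctGT.exists_typeForks (h : KappaIctGT ℓ T ℵ₀) :
    ∃ (N : ModelType.{u, v, max u v} T) (B : Set N) (m : ℕ) (N₀ : ModelType.{u, v, max u v} T)
      (f₀ : N ↪ₑ[L] N₀) (c₀ : Fin m → N₀), ∀ (M n : ℕ) (A : Set N), 2 ≤ M → A ⊆ B → A.Finite →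
        TypeForks ℓ M n f₀ A B c₀ := by
  obtain ⟨N, B, m, p, hp, hfork⟩ := h
  obtain ⟨N₀, f₀, c₀, hc₀⟩ := exists_realize_of_finitely_satisfiable N
    ((fun φ : L.Formula (B ⊕ Fin m) => (φ.relabel (Sum.map (fun b : B => (b : N)) ULift.up) :
        L.Formula (N ⊕ ULift.{max u v} (Fin m)))) '' p) (by
    intro q hq hfin
    obtain ⟨q₁, hq₁, hfin₁, rfl⟩ := Set.exists_subset_image_finite_and.1 ⟨q, hq, hfin, rfl⟩
    obtain ⟨c, hc⟩ := hp q₁ hq₁ hfin₁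
    refine ⟨c ∘ ULift.down, ?_⟩
    rintro _ ⟨φ, hφ, rfl⟩
    rw [Formula.realize_relabel, Sum.elim_comp_map]
    exact hc φ hφ)
  refine ⟨N, B, m, N₀, f₀, fun i => c₀ ⟨i⟩, fun M n A hM hA hfin => ?_⟩
  obtain ⟨N', f, hf⟩ := (hfork n A hA (lt_aleph0_iff_set_finite.2 hfin)).exists_isDistinguished hM
  refine ⟨N', f, fun N'' g c hc => hf N'' g c fun φ hφ => (hc φ).2 ?_⟩
  have := hc₀ _ ⟨φ, hφ, rfl⟩
  rwa [Formula.realize_relabel, Sum.elim_comp_map] at this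

/-- A single gap `M` is enough here, while `KappaIctGT.exists_typeForks` supplies every gap `M ≥ 2`.
The argument for sums relies on this asymmetry. -/
theorem kappaIctGT_of_typeForks (hM : 1 ≤ M) {N N₀ : ModelType.{u, v, max u v} T} {B : Set N}
    {f₀ : N ↪ₑ[L] N₀} {μ : Type} [Finite μ] {c₀ : μ → N₀}
    (h : ∀ (n : ℕ) (A : Set N), A ⊆ B → A.Finite → TypeForks ℓ M n f₀ A B c₀) :
    KappaIctGT ℓ T ℵ₀ := by
  obtain ⟨m, ⟨e⟩⟩ : ∃ m, Nonempty (μ ≃ Fin m) := ⟨_, ⟨Finite.equivFin _⟩⟩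
  refine ⟨N, B, m, {φ | φ.Realize (Sum.elim (fun b : B => f₀ b) (c₀ ∘ e.symm))}, ?_, ?_⟩
  · intro q hq hfin
    have : Finite q := hfin
    have h0 : EqTp L (fun b : B => (b : N)) (fun b : B => f₀ b) :=
      (eqTp_embedding f₀ (fun b : B => (b : N))).symm
    obtain ⟨c, hc⟩ := h0.exists_realize (φ := Formula.iInf fun ψ : q => ψ.1)
      (Formula.realize_iInf.2 fun ψ => hq ψ.2)
    exact ⟨c, fun ψ hψ => Formula.realize_iInf.1 hc ⟨ψ, hψ⟩⟩
  · intro n A hA hfin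
    obtain ⟨N', f, hf⟩ := h n A hA (lt_aleph0_iff_set_finite.1 hfin)
    refine ictForks_of_isDistinguished (f := f) hM fun N'' g c hc => ?_
    have := (hf N'' g (c ∘ e) ?_).comp_equiv e.symm
    · convert this using 1
      ext
      simp
    · have : EqTp L (Sum.elim (fun b : B => g (f b)) c)
          (Sum.elim (fun b : B => f₀ b) (c₀ ∘ e.symm)) := by
        intro φ
        refine ⟨fun h1 => ?_, fun h1 => hc φ h1⟩
        by_contra h2
        exact (Formula.realize_not.1 (hc φ.not (Formula.realize_not.2 h2))) h1
      refine this.of_comp (Sum.map id e) ?_ ?_ <;> rintro (x | x) <;> simp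

end Forking

/-! ### Regrouping the indices of a configuration into blocks. -/

section Blocks

open FirstOrder.Language

/-- Data which regroup natural numbers into an initial part of length `P`, listed by `pre`, and
increasing blocks of length `K`, the `k`-th member of the `x`-th block being `β x k`. The
position `j` of a sequence is to be found in the initial part if `j < P`, and otherwise at the
place `kk j` of the block number `blk j` of the sequence of blocks considered. -/
structure Regrouping (n : ℕ) where
  P : ℕ
  K : ℕ
  v : ℕ → ℕ
  pre : ℕ → ℕ
  β : ℕ → ℕ → ℕ
  blk : ℕ → ℕ
  kk : ℕ → ℕ
  v_zero : v 0 = P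
  pre_lt : ∀ y y', y < y' → pre y < pre y'
  pre_lt_β : ∀ y x k, y < P → pre y < β x k
  β_lt : ∀ x k k', k < k' → k' < K → β x k < β x k'
  β_lt_β : ∀ x x' k k', x < x' → k < K → k' < K → β x k < β x' k'
  kk_lt : ∀ i j, i < n → P ≤ j → j < v i → kk j < K
  blk_lt : ∀ i j, i < n → P ≤ j → j < v i → blk j < i
  lex : ∀ j j', P ≤ j → j < j' → blk j < blk j' ∨ blk j = blk j' ∧ kk j < kk j'

/-- The extension by zero of a finite sequence. -/
def extendSeq {r : ℕ} (η : Fin r → ℕ) (j : ℕ) : ℕ := if h : j < r then η ⟨j, h⟩ else 0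

theorem extendSeq_of_lt {r : ℕ} (η : Fin r → ℕ) {j : ℕ} (h : j < r) :
    extendSeq η j = η ⟨j, h⟩ := dif_pos h

theorem extendSeq_lt {r : ℕ} {η : Fin r → ℕ} (h : StrictMono η) {j j' : ℕ} (hj : j < j')
    (hj' : j' < r) : extendSeq η j < extendSeq η j' := by
  rw [extendSeq_of_lt η hj', extendSeq_of_lt η (hj.trans hj')]
  exact h hj

namespace Regrouping

variable {n : ℕ} (D : Regrouping n)

/-- The sequence obtained from the sequence `f` of blocks. -/
def sel (f : ℕ → ℕ) (j : ℕ) : ℕ :=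
  if j < D.P then D.pre j else D.β (f (D.blk j)) (D.kk j)

/-- The enumeration of the initial part and of the blocks whose numbers are listed by `f`. -/
def addr (f : ℕ → ℕ) (y : ℕ) : ℕ :=
  if y < D.P then D.pre y else D.β (f ((y - D.P) / D.K)) ((y - D.P) % D.K)

/-- The position of the `j`-th member of `sel f` within the enumeration `addr`. -/
def pos (f : ℕ → ℕ) (j : ℕ) : ℕ :=
  if j < D.P then j else D.P + (D.K * f (D.blk j) + D.kk j)

theorem sel_lt {f : ℕ → ℕ} {i : ℕ} (hi : i < n)
    (hf : ∀ j j', j < j' → j' < i → f j < f j') {j j' : ℕ} (hj : j < j') (hj' : j' < D.v i) :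
    D.sel f j < D.sel f j' := by
  unfold sel
  split_ifs with h1 h2 h2
  · exact D.pre_lt _ _ hj
  · exact D.pre_lt_β _ _ _ h1
  · omega
  · have k1 := D.kk_lt i j hi (by omega) (by omega)
    have k2 := D.kk_lt i j' hi (by omega) (by omega)
    rcases D.lex j j' (by omega) hj with h | ⟨h, h'⟩
    · exact D.β_lt_β _ _ _ _ (hf _ _ h (D.blk_lt i j' hi (by omega) hj')) k1 k2
    · rw [h]
      exact D.β_lt _ _ _ h' k2

theorem pos_lt {f : ℕ → ℕ} {i : ℕ} (hi : i < n)
    (hf : ∀ j j', j < j' → j' < i → f j < f j') {j j' : ℕ} (hj : j < j') (hj' : j' < D.v i) :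
    D.pos f j < D.pos f j' := by
  unfold pos
  split_ifs with h1 h2 h2
  · exact hj
  · omega
  · omega
  · have k1 := D.kk_lt i j hi (by omega) (by omega)
    rcases D.lex j j' (by omega) hj with h | ⟨h, h'⟩
    · have := hf _ _ h (D.blk_lt i j' hi (by omega) hj')
      have := Nat.mul_le_mul_left D.K (Nat.succ_le_of_lt this)
      rw [Nat.succ_eq_add_one, Nat.mul_add, mul_one] at this
      omega
    · rw [h]
      omega

theorem pos_lt_length {f : ℕ → ℕ} {i r : ℕ} (hi : i < n) (hf : ∀ j < i, f j < r) {j : ℕ}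
    (hj : j < D.v i) : D.pos f j < D.P + D.K * r := by
  unfold pos
  split_ifs with h1
  · omega
  · have k1 := D.kk_lt i j hi (by omega) hj
    have := Nat.mul_le_mul_left D.K (Nat.succ_le_of_lt (hf _ (D.blk_lt i j hi (by omega) hj)))
    rw [Nat.succ_eq_add_one, Nat.mul_add, mul_one] at this
    omega

theorem addr_block {f : ℕ → ℕ} {x k : ℕ} (hk : k < D.K) :
    D.addr f (D.P + (D.K * x + k)) = D.β (f x) k := by
  unfold addr
  have hK : 0 < D.K := by omega
  rw [if_neg (by omega), Nat.add_sub_cancel_left, Nat.mul_add_div hK, Nat.mul_add_mod,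
    Nat.div_eq_of_lt hk, Nat.mod_eq_of_lt hk, add_zero]

theorem addr_pos {f f' : ℕ → ℕ} {i : ℕ} (hi : i < n) {j : ℕ} (hj : j < D.v i) :
    D.addr f (D.pos f' j) = D.sel (f ∘ f') j := by
  unfold pos sel
  split_ifs with h1
  · simp [addr, h1]
  · rw [D.addr_block (D.kk_lt i j hi (by omega) hj)]
    rfl

theorem sel_congr {f f' : ℕ → ℕ} {i : ℕ} (hi : i < n) (h : ∀ l < i, f l = f' l) {j : ℕ}
    (hj : j < D.v i) : D.sel f j = D.sel f' j := by
  unfold sel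
  split_ifs with h1
  · rfl
  · rw [h _ (D.blk_lt i j hi (by omega) hj)]

theorem addr_lt {f : ℕ → ℕ} {r : ℕ} (hf : ∀ j j', j < j' → j' < r → f j < f j') {y y' : ℕ}
    (hy : y < y') (hy' : y' < D.P + D.K * r) : D.addr f y < D.addr f y' := by
  unfold addr
  split_ifs with h1 h2 h2
  · exact D.pre_lt _ _ hy
  · exact D.pre_lt_β _ _ _ h1
  · omega
  · have hK : 0 < D.K := by
      rcases Nat.eq_zero_or_pos D.K with h | h
      · rw [h, Nat.zero_mul] at hy'; omega
      · exact h
    have k1 := Nat.mod_lt (y - D.P) hK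
    have k2 := Nat.mod_lt (y' - D.P) hK
    rcases (Nat.div_le_div_right (c := D.K) (show y - D.P ≤ y' - D.P by omega)).eq_or_lt with h | h
    · have e1 := Nat.div_add_mod (y - D.P) D.K
      have e2 := Nat.div_add_mod (y' - D.P) D.K
      rw [h] at e1 ⊢
      exact D.β_lt _ _ _ (by omega) k2
    · exact D.β_lt_β _ _ _ _ (hf _ _ h (Nat.div_lt_of_lt_mul (by omega))) k1 k2

/-- The sequence of numbers obtained from a finite increasing sequence of blocks. -/
def selEmb {i l : ℕ} (hi : i < n) (hl : l = D.v i) (η : Fin i ↪o ℕ) : Fin l ↪o ℕ :=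
  OrderEmbedding.ofStrictMono (fun j => D.sel (extendSeq η) j) fun _ j' h =>
    D.sel_lt hi (fun _ _ => extendSeq_lt η.strictMono) h (hl ▸ j'.2)

/-- The initial part as a finite increasing sequence. -/
def preEmb (l : ℕ) : Fin l ↪o ℕ :=
  OrderEmbedding.ofStrictMono (fun j => D.pre j) fun _ _ h => D.pre_lt _ _ h

/-- The enumeration of the initial part and finitely many blocks. -/
def addrEmb {r : ℕ} (f : Fin r ↪o ℕ) : Fin (D.P + D.K * r) ↪o ℕ :=
  OrderEmbedding.ofStrictMono (fun y => D.addr (extendSeq f) y) fun _ y' h =>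
    D.addr_lt (fun _ _ => extendSeq_lt f.strictMono) h y'.2

/-- The positions of the members of a sequence obtained from blocks. -/
def posEmb {i l r : ℕ} (hi : i < n) (hl : l = D.v i) (η : Fin i ↪o Fin r) :
    Fin l ↪o Fin (D.P + D.K * r) :=
  have hη : ∀ j < i, extendSeq (fun j => (η j : ℕ)) j < r := fun j hj => by
    rw [extendSeq_of_lt _ hj]; exact (η _).2
  OrderEmbedding.ofStrictMono
    (fun j => ⟨D.pos (extendSeq fun j => (η j : ℕ)) j, D.pos_lt_length hi hη (hl ▸ j.2)⟩)
    fun j j' h => D.pos_lt hi (fun _ _ => extendSeq_lt fun _ _ h => η.strictMono h) h (hl ▸ j'.2)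

/-- The source of indiscernibility after regrouping: the positions of the selected indices within
the enumeration depend only on `η`, and changing `f` changes only the enumeration. -/
theorem selEmb_trans {i l r : ℕ} (hi : i < n) (hl : l = D.v i) (η : Fin i ↪o Fin r)
    (f : Fin r ↪o ℕ) :
    D.selEmb hi hl (η.trans f) = (D.posEmb hi hl η).trans (D.addrEmb f) := by
  ext j
  have hj : (j : ℕ) < D.v i := hl ▸ j.2
  change D.sel _ _ = D.addr _ (D.pos _ _)
  rw [D.addr_pos hi hj]
  refine D.sel_congr hi (fun j hj => ?_) hj
  rw [Function.comp_apply, extendSeq_of_lt _ hj, extendSeq_of_lt (fun j => (η j : ℕ)) hj,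
    extendSeq_of_lt _ (η _).2]
  rfl

end Regrouping

variable {L : FirstOrder.Language.{u, v}} {ℓ : IctKind} {N : Type*} [L.Structure N] {A : Set N}

/-- The configuration whose sequence consists of blocks of a given one, together with all members
attached to the initial part. -/
def Config.regroup (S : Config L ℓ A ℕ) {n : ℕ} (D : Regrouping n) : Config L ℓ A ℕ where
  κ := (Fin D.P × S.κ) ⊕ (Fin D.K × S.κ) ⊕ {y : S.Y // S.len y = D.P}
  -- The members attached to the initial part would belong to the empty sequence of blocks, which
  -- for kind two can carry nothing. They are made coordinates of every tuple instead, whence `1 ≤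
  -- i` here and the third summand of `κ`.
  Y := Σ i : Fin n, {y : S.Y // 1 ≤ (i : ℕ) ∧ S.len y = D.v i}
  finite_κ := by
    have := S.finite_κ
    have := S.finite_Y
    infer_instance
  finite_Y := by
    have := S.finite_Y
    infer_instance
  len := fun y => y.1
  a := fun x => Sum.elim (fun z => S.a (D.pre z.1) z.2)
    (Sum.elim (fun z => S.a (D.β x z.1) z.2) fun y => S.b y (D.preEmb _))
  b := fun y η => S.b y.2 (D.selEmb y.1.2 y.2.2.2 η)
  indisc := by
    intro r f g
    have hpre : ∀ (f : Fin r ↪o ℕ) (j : ℕ) (h : j < D.P + D.K * r), j < D.P →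
        D.addrEmb f ⟨j, h⟩ = D.pre j := fun _ _ _ hj => if_pos hj
    have hblk : ∀ (f : Fin r ↪o ℕ) (x : Fin r) (k : Fin D.K)
        (h : D.P + (D.K * x + k) < D.P + D.K * r),
        D.addrEmb f ⟨D.P + (D.K * x + k), h⟩ = D.β (f x) k := fun f x k h => by
      change D.addr _ _ = _
      rw [D.addr_block k.2, extendSeq_of_lt _ x.2]
    have hlt : ∀ (x : Fin r) (k : Fin D.K), D.P + (D.K * x + k) < D.P + D.K * r := fun x k => by
      have := Nat.mul_le_mul_left D.K (Nat.succ_le_of_lt x.2)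
      rw [Nat.succ_eq_add_one, Nat.mul_add, mul_one] at this
      omega
    have hP : D.P ≤ D.P + D.K * r := Nat.le_add_right _ _
    let e : (Fin r × ((Fin D.P × S.κ) ⊕ (Fin D.K × S.κ) ⊕ {y : S.Y // S.len y = D.P})) ⊕
        (Σ y : Σ i : Fin n, {y : S.Y // 1 ≤ (i : ℕ) ∧ S.len y = D.v i}, Fin (y.1 : ℕ) ↪o Fin r) →
        (Fin (D.P + D.K * r) × S.κ) ⊕ (Σ y, Fin (S.len y) ↪o Fin (D.P + D.K * r))
      | .inl (_, .inl z) => .inl (⟨z.1, z.1.2.trans_le hP⟩, z.2)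
      | .inl (x, .inr (.inl z)) => .inl (⟨D.P + (D.K * x + z.1), hlt _ _⟩, z.2)
      | .inl (_, .inr (.inr y)) => .inr ⟨y, Fin.castLEOrderEmb (y.2.le.trans hP)⟩
      | .inr y => .inr ⟨y.1.2, D.posEmb y.1.1.2 y.1.2.2.2 y.2⟩
    refine (S.indisc _ (D.addrEmb f) (D.addrEmb g)).comp e ?_ ?_
    all_goals
      rintro (⟨x, ⟨j, z⟩ | ⟨k, z⟩ | y⟩ | ⟨y, η⟩)
      · simp [configFam, hpre, e]
      · simp [configFam, hblk, e]
      · simp only [configFam, Sum.elim_inl, Sum.elim_inr, e]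
        congr 1
        ext j
        exact (if_pos (j.2.trans_eq y.2)).symm
      · simp only [configFam, Sum.elim_inr, e]
        rw [D.selEmb_trans]
  adm := by
    have had := S.adm
    cases ℓ with
    | one =>
      have : IsEmpty S.Y := had
      exact ⟨fun y => this.elim y.2.1⟩
    | two =>
      rintro ⟨i, y, hi, hy⟩
      obtain ⟨j, z, hz⟩ := had y
      have hj : (j : ℕ) < D.v i := hy ▸ j.2
      by_cases hjP : (j : ℕ) < D.P
      -- The initial part is contained in every block tuple, so the first block of the nonempty
      -- sequence provides it.
      · refine ⟨⟨0, hi⟩, Sum.inl (⟨j, hjP⟩, z), fun η => (hz _).trans ?_⟩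
        exact congrArg (fun x => S.a x z) (if_pos hjP)
      · refine ⟨⟨D.blk j, D.blk_lt i j i.2 (by omega) hj⟩,
          Sum.inr (Sum.inl (⟨D.kk j, D.kk_lt i j i.2 (by omega) hj⟩, z)), fun η => (hz _).trans ?_⟩
        refine congrArg (fun x => S.a x z) ((if_neg hjP).trans ?_)
        rw [extendSeq_of_lt]
    | three => trivial

/-- A common part `d` of two tuples can be moved to the parameters. -/
theorem SameType.union {α β : Type} {d : β → N} {x y : α → N}
    (h : SameType L A (Sum.elim d x) (Sum.elim d y)) : SameType L (A ∪ Set.range d) x y := by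
  rw [sameType_iff_eqTp (Sum.elim (fun a : A => (a : N)) d) (by
    rw [Set.Sum.elim_range]; simp)]
  exact (h.eqTp (fun a : A => (a : N)) fun a => a.2).of_comp
    (Sum.elim (Sum.elim Sum.inl fun b => Sum.inr (Sum.inl b)) fun a => Sum.inr (Sum.inr a))
    (by rintro ((z | z) | z) <;> rfl) (by rintro ((z | z) | z) <;> rfl)

/-- Passing from block tuples to their `k`-th members loses no parameters: those attached to the
selected indices were kept, either as attached members or, for `i = 0`, as common coordinates of the
block tuples. -/
theorem Config.sameType_of_regroup {N' : Type*} [L.Structure N'] {g : N → N'} {μ : Type}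
    {c : μ → N'} (S : Config L ℓ A ℕ) {n : ℕ} (D : Regrouping n) {s : ℕ → ℕ} (hs : StrictMono s)
    {i k : ℕ} (hi : i < n) (hk : k < D.K) {x y : ℕ}
    (h : SameType L (g '' (A ∪ (S.regroup D).params s i))
      (Sum.elim c (g ∘ (S.regroup D).a x)) (Sum.elim c (g ∘ (S.regroup D).a y))) :
    SameType L (g '' (A ∪ S.params (D.sel s) (D.v i)))
      (Sum.elim c (g ∘ S.a (D.β x k))) (Sum.elim c (g ∘ S.a (D.β y k))) := by
  rcases Nat.eq_zero_or_pos i with rfl | hpos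
  · let d : {y : S.Y // S.len y = D.P} → N' := fun y => g (S.b y (D.preEmb _))
    have h1 : SameType L (g '' A) (Sum.elim (d) (Sum.elim c (g ∘ S.a (D.β x k))))
        (Sum.elim (d) (Sum.elim c (g ∘ S.a (D.β y k)))) := by
      refine (h.mono (Set.image_mono Set.subset_union_left)).comp
        (Sum.elim (fun y => Sum.inr (Sum.inr (Sum.inr y)))
          (Sum.elim Sum.inl fun z => Sum.inr (Sum.inr (Sum.inl (⟨k, hk⟩, z))))) ?_ ?_ <;>
        rintro (z | z | z) <;> rfl
    refine h1.union.mono ?_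
    rw [Set.image_union]
    refine Set.union_subset_union_right _ ?_
    rintro _ ⟨_, ⟨y, hy, η, hη, rfl⟩, rfl⟩
    rw [D.v_zero] at hy
    refine ⟨⟨y, hy⟩, ?_⟩
    have : η = D.preEmb _ := by
      ext j
      rw [hη]
      exact if_pos (j.2.trans_eq hy)
    rw [this]
  · refine (h.mono (Set.image_mono ?_)).comp
      (Sum.map id fun z => Sum.inr (Sum.inl (⟨k, hk⟩, z))) ?_ ?_
    · refine Set.union_subset_union_right _ ?_
      rintro _ ⟨y, hy, η, hη, rfl⟩
      let s' : Fin i ↪o ℕ := OrderEmbedding.ofStrictMono (fun j => s j) fun _ _ h => hs h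
      refine ⟨⟨⟨i, hi⟩, y, hpos, hy⟩, rfl, s', fun _ => rfl, ?_⟩
      have : η = D.selEmb hi hy s' := by
        ext j
        rw [hη]
        refine D.sel_congr hi (fun j hj => ?_) (j.2.trans_eq hy)
        rw [extendSeq_of_lt _ hj]
        rfl
      rw [this]
      rfl
    all_goals rintro (z | z) <;> rfl

end Blocks

/-! ### Selecting some of the distinguished pairs without losing parameters. -/

section Spread

open FirstOrder.Language

/-- The offset of the `k`-th member of a block which starts with `M * v` and contains all the
multiples of `M` below `M * (v + d)`. -/
def blockOffset (M d k : ℕ) : ℕ :=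
  if k = 0 then 0 else if k = 1 then 1 else if k ≤ d then M * (k - 1) else M * (d - 1) + k

theorem blockOffset_le {M d : ℕ} (hd : 2 ≤ d) (k : ℕ) :
    blockOffset M d k ≤ M * (d - 1) + k := by
  unfold blockOffset
  split_ifs with h1 h2 h3
  · omega
  · omega
  · have : M * (k - 1) ≤ M * (d - 1) := Nat.mul_le_mul_left _ (by omega)
    omega
  · exact le_rfl

theorem blockOffset_lt {M d k k' : ℕ} (hM : 2 ≤ M) (hd : 2 ≤ d) (hk : k < k') :
    blockOffset M d k < blockOffset M d k' := by
  have h : ∀ k, blockOffset M d k < blockOffset M d (k + 1) := by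
    intro k
    unfold blockOffset
    rcases Nat.lt_or_ge k 2 with h2 | h2
    · interval_cases k
      · simp
      · simp [hd]
        omega
    · have h3 : k ≠ 0 := by omega
      have h4 : k ≠ 1 := by omega
      have h5 : k + 1 ≠ 1 := by omega
      simp only [h3, h4, h5, Nat.add_one_ne_zero, if_false, Nat.add_sub_cancel]
      split_ifs with h6 h7
      · exact Nat.mul_lt_mul_of_pos_left (by omega) (by omega)
      · have : M * (k - 1) ≤ M * (d - 1) := Nat.mul_le_mul_left _ (by omega)
        omega
      · omega
      · omega
  exact strictMono_nat_of_lt_succ h hk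

theorem exists_findBlock {v : ℕ → ℕ} (hv : StrictMono v) :
    ∃ blk : ℕ → ℕ, ∀ j, v 0 ≤ j → v (blk j) ≤ j ∧ j < v (blk j + 1) := by
  classical
  refine ⟨fun j => Nat.findGreatest (fun l => v l ≤ j) j, fun j hj => ⟨?_, ?_⟩⟩
  · exact Nat.findGreatest_spec (P := fun l => v l ≤ j) (Nat.zero_le _) hj
  · by_contra h
    push Not at h
    have h1 := (hv.le_apply (x := Nat.findGreatest (fun l => v l ≤ j) j + 1)).trans h
    have := Nat.le_findGreatest (P := fun l => v l ≤ j) h1 h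
    omega

/-- Every second element of `X` is taken. A gap of at least 2 puts `M * (v i + 1)`, a possible value
of `t (v i)`, strictly before `M * v (i + 1)`. -/
theorem exists_sparse {n n₁ : ℕ} {X : Finset ℕ} (hX : X ⊆ Finset.range n) (h : 2 * n₁ ≤ X.card) :
    ∃ v : ℕ → ℕ, (∀ i, v i + 2 ≤ v (i + 1)) ∧ ∀ i < n₁, v i ∈ X := by
  let e := X.orderEmbOfFin rfl
  -- The values `n + 2 * i` from `n₁` on are fillers above `X` which preserve the gaps.
  refine ⟨fun i => if hi : i < n₁ then e ⟨2 * i, by omega⟩ else n + 2 * i, fun i => ?_,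
    fun i hi => ?_⟩
  · by_cases h1 : i + 1 < n₁
    · have h2 : i < n₁ := by omega
      simp only [h1, h2, dif_pos]
      have h3 : e ⟨2 * i, by omega⟩ < e ⟨2 * i + 1, by omega⟩ := e.strictMono (by simp [Fin.lt_def])
      have h4 : e ⟨2 * i + 1, by omega⟩ < e ⟨2 * (i + 1), by omega⟩ :=
        e.strictMono (by simp only [Fin.lt_def]; omega)
      omega
    · by_cases h2 : i < n₁
      · simp only [h1, h2, dif_pos, dif_neg, not_false_iff]
        have := Finset.mem_range.1 (hX (X.orderEmbOfFin_mem rfl ⟨2 * i, by omega⟩))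
        change _ < n at this
        simp only [e]
        omega
      · simp only [h1, h2, dif_neg, not_false_iff]
        omega
  · simp only [hi, dif_pos]
    exact X.orderEmbOfFin_mem rfl _

/-- The regrouping of the natural numbers along a sparse sequence `v`: the block of number `2 * i`
contains the multiples of `M` from `M * v i` on and below `M * v (i + 1)`, and the next one is an
interval whose `q i`-th member does not depend on `q i`. -/
theorem exists_regrouping {n n₁ M : ℕ} (hM : 4 * (n + 3) + 10 ≤ M) {v q : ℕ → ℕ}
    (hv : ∀ i, v i + 2 ≤ v (i + 1)) (hvn : ∀ i < n₁, v i < n) (hq : ∀ i, q i ≤ 2) :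
    ∃ D : Regrouping n₁, D.v = v ∧ D.K = n + 3 ∧
      (∀ i, D.β (2 * i) (q i) = M * v i + blockOffset M (v (i + 1) - v i) (q i)) ∧
      (∀ i, D.β (2 * i + 1) (q i) = M * v i + M * (v (i + 1) - v i - 1) + 2 * (n + 3) + 2) ∧
      ∀ i < n₁, ∀ j < v i, D.sel (fun x => 2 * x) j = M * j := by
  have hvm : StrictMono v := strictMono_nat_of_lt_succ fun i => by have := hv i; omega
  obtain ⟨blk, hblk⟩ := exists_findBlock hvm
  -- Both blocks belonging to `v i` end before `M * v (i + 1)`; the lower bound on `M` leaves room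
  -- for this in the last gap. The shift by `q` fixes the `q`-th member of the odd block in advance,
  -- since `q` itself is going to be chosen by comparison with that member. The subtraction is not
  -- truncated, as `q ≤ 2`.
  let β : ℕ → ℕ → ℕ := fun x k =>
    if x % 2 = 0 then M * v (x / 2) + blockOffset M (v (x / 2 + 1) - v (x / 2)) k
    else M * v (x / 2) + M * (v (x / 2 + 1) - v (x / 2) - 1) + 2 * (n + 3) + 2 + k - q (x / 2)
  have he : ∀ i k, β (2 * i) k = M * v i + blockOffset M (v (i + 1) - v i) k := fun i k => by
    have h1 : 2 * i / 2 = i := by omega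
    simp [β, h1]
  have ho : ∀ i k, β (2 * i + 1) k =
      M * v i + M * (v (i + 1) - v i - 1) + 2 * (n + 3) + 2 + k - q i := fun i k => by
    have h1 : (2 * i + 1) / 2 = i := by omega
    have h2 : (2 * i + 1) % 2 = 1 := by omega
    simp [β, h1, h2]
  have hstep : ∀ i, M * v (i + 1) = M * v i + M * (v (i + 1) - v i - 1) + M := fun i => by
    obtain ⟨d, hd⟩ := Nat.exists_eq_add_of_le (hv i)
    rw [hd, show v i + 2 + d - v i - 1 = d + 1 by omega]
    ring
  have hβ : ∀ x k k', k < k' → β x k < β x k' := by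
    intro x k k' hk
    rcases Nat.even_or_odd' x with ⟨i, rfl | rfl⟩
    · rw [he, he]
      have := blockOffset_lt (M := M) (d := v (i + 1) - v i) (by omega)
        (by have := hv i; omega) hk
      omega
    · rw [ho, ho]
      have := hq i
      omega
  have hβs : ∀ x k k', k < n + 3 → β x k < β (x + 1) k' := by
    intro x k k' hk
    rcases Nat.even_or_odd' x with ⟨i, rfl | rfl⟩
    · rw [he, ho]
      have := blockOffset_le (M := M) (d := v (i + 1) - v i) (by have := hv i; omega) k
      have := hq i
      omega
    · rw [show 2 * i + 1 + 1 = 2 * (i + 1) by ring, ho, he, hstep]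
      omega
  have hβlt : ∀ x x' k k', x < x' → k < n + 3 → k' < n + 3 → β x k < β x' k' := by
    intro x x' k k' hx hk
    induction x', hx using Nat.le_induction generalizing k' with
    | base => exact fun _ => hβs x k k' hk
    | succ y hy ih => exact fun _ => (ih k hk).trans (hβs y k k' hk)
  have hpre : ∀ x k, M * v 0 ≤ β x k := by
    intro x k
    have : M * v 0 ≤ M * v (x / 2) := Nat.mul_le_mul_left _ (hvm.monotone (Nat.zero_le _))
    have := hq (x / 2)
    simp only [β]
    split_ifs <;> omega
  have hblk_lt : ∀ i j, v 0 ≤ j → j < v i → blk j < i := fun i j h0 hj =>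
    hvm.lt_iff_lt.1 ((hblk j h0).1.trans_lt hj)
  -- Place 1 of an even block is taken by `M * v i + 1`, so the multiples of `M` after the first one
  -- are moved up by one place.
  let kk : ℕ → ℕ := fun j => if j = v (blk j) then 0 else j - v (blk j) + 1
  let D : Regrouping n₁ :=
    { P := v 0
      K := n + 3
      v := v
      pre := fun y => M * y
      β := β
      blk := blk
      kk := kk
      v_zero := rfl
      pre_lt := fun y y' h => Nat.mul_lt_mul_of_pos_left h (by omega)
      pre_lt_β := fun y x k h =>
        (Nat.mul_lt_mul_of_pos_left h (by omega)).trans_le (hpre x k)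
      β_lt := fun x k k' h _ => hβ x k k' h
      β_lt_β := hβlt
      kk_lt := fun i j hi h0 hj => by
        have := hvn i hi
        simp only [kk]
        split_ifs <;> omega
      blk_lt := fun i j _ h0 hj => hblk_lt i j h0 hj
      lex := fun j j' h0 hj => by
        have h1 := hblk j h0
        have h2 := hblk j' (h0.trans hj.le)
        have h3 : blk j < blk j' + 1 := hvm.lt_iff_lt.1 (by omega)
        rcases (Nat.lt_succ_iff.1 h3).lt_or_eq with h | h
        · exact Or.inl h
        · refine Or.inr ⟨h, ?_⟩
          simp only [kk, ← h] at h2 ⊢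
          split_ifs <;> omega }
  refine ⟨D, rfl, rfl, fun i => he i _, fun i => (ho i _).trans (by omega), fun i hi j hj => ?_⟩
  unfold Regrouping.sel
  split_ifs with h
  · rfl
  · have h0 : v 0 ≤ j := not_lt.1 h
    have h1 := hblk j h0
    change β (2 * blk j) (kk j) = M * j
    rw [he]
    simp only [kk]
    split_ifs with h2
    · rw [← h2]
      simp [blockOffset]
    · rw [blockOffset, if_neg (by omega), if_neg (by omega), if_pos (by omega),
        Nat.add_sub_cancel, ← Nat.mul_add]
      congr 1
      omega

variable {L : FirstOrder.Language.{u, v}} {ℓ : IctKind} {N N' : Type*} [L.Structure N]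
  [L.Structure N'] {A : Set N}

open Classical in
/-- A tuple which distinguishes no `n₁` adjacent pairs in any configuration distinguishes less than
`2 * n₁` pairs in a configuration with sufficiently large gaps. -/
theorem Config.card_differs_lt {g : N → N'} {μ : Type} {c : μ → N'} {n₁ : ℕ}
    (hgood : ¬ IsDistinguished L ℓ 2 n₁ A g c) (S : Config L ℓ A ℕ) {n M : ℕ}
    (hM : 4 * (n + 3) + 10 ≤ M) {t : ℕ → ℕ} (ht : ∀ i, t i = M * i + 1 ∨ t i = M * (i + 1)) :
    ((Finset.range n).filter fun i => S.Differs g c (fun j => M * j) t i).card < 2 * n₁ := by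
  by_contra hcard
  push Not at hcard
  obtain ⟨v, hv, hvX⟩ := exists_sparse (Finset.filter_subset _ _) hcard
  have hvd : ∀ i < n₁, S.Differs g c (fun j => M * j) t (v i) := fun i hi =>
    (Finset.mem_filter.1 (hvX i hi)).2
  have hvn : ∀ i < n₁, v i < n := fun i hi =>
    Finset.mem_range.1 (Finset.mem_filter.1 (hvX i hi)).1
  let E : ℕ → ℕ → ℕ → Prop := fun i x y => SameType L (g '' (A ∪ S.params (fun j => M * j) (v i)))
    (Sum.elim c (g ∘ S.a x)) (Sum.elim c (g ∘ S.a y))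
  -- A reference index in the gap just before `M * v (i + 1)`.
  let w : ℕ → ℕ := fun i => M * v i + M * (v (i + 1) - v i - 1) + 2 * (n + 3) + 2
  -- By transitivity, the tuples at `M * v i` and at `t (v i)` cannot both have the type of the one
  -- at `w i`. The values 0, 1, 2 of `q` point at `M * v i`, `M * v i + 1` and `M * (v i + 1)`.
  have hq : ∀ i, ∃ q ≤ 2, i < n₁ →
      ¬ E i (M * v i + blockOffset M (v (i + 1) - v i) q) (w i) := by
    intro i
    by_cases hi : i < n₁
    · by_contra hcon
      push Not at hcon
      have h2 : 2 ≤ v (i + 1) - v i := by have := hv i; omega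
      have h0 := (hcon 0 (by omega)).2
      have h1 := (hcon 1 (by omega)).2
      have h3 := (hcon 2 le_rfl).2
      simp only [blockOffset, if_true, add_zero, one_ne_zero, if_false, h2,
        OfNat.ofNat_ne_zero, OfNat.ofNat_ne_one, Nat.add_one_sub_one, mul_one] at h0 h1 h3
      refine hvd i hi (h0.trans ?_)
      rcases ht (v i) with h | h
      · rw [h]
        exact h1.symm
      · rw [h, Nat.mul_add, mul_one]
        exact h3.symm
    · exact ⟨0, by omega, fun h => absurd h hi⟩
  choose q hq2 hq using hq
  obtain ⟨D, rfl, hK, he, ho, hsel⟩ := exists_regrouping hM hv hvn hq2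
  -- Blocks `2 * i` and `2 * i + 1` differ at their `q i`-th members, and the initial part with the
  -- blocks `0, 2, …, 2 * (i - 1)` contains all `M * j` for `j < v i`, so the old parameters are
  -- available.
  refine hgood ⟨S.regroup D, fun i => 2 * i + 1, fun i => Or.inl rfl, fun i hi hsame => ?_⟩
  have h := S.sameType_of_regroup D (s := fun x => 2 * x)
    (fun x y h => by dsimp only; omega) hi (k := q i) (by have := hq2 i; omega) hsame
  rw [he, ho] at h
  refine hq i hi (h.mono (Set.image_mono (Set.union_subset_union_right _ ?_)))
  rintro _ ⟨y, hy, η, hη, rfl⟩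
  exact ⟨y, hy, η, fun j => (hη j).trans (hsel i hi j (hy ▸ j.2)).symm, rfl⟩

end Spread

/-! ### Feferman–Vaught decomposition of formulas over a sum. -/

section FefermanVaught

open FirstOrder.Language FirstOrder.Language.Structure

variable {τ : FirstOrder.Language.{u, v}}

instance : sideLanguage.IsRelational := fun _ => inferInstanceAs (IsEmpty Empty)

/-- In a relational language, each term is a variable. -/
def termVar {L : FirstOrder.Language.{u, v}} [L.IsRelational] {α : Type*} : L.Term α → α
  | .var a => a
  | .func f _ => isEmptyElim f

theorem realize_termVar {L : FirstOrder.Language.{u, v}} [L.IsRelational] {N α : Type*}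
    [L.Structure N] (t : L.Term α) (x : α → N) : t.realize x = x (termVar t) := by
  cases t with
  | var a => rfl
  | func f _ => exact isEmptyElim f

/-- The unary predicate `L` or `R`, as a symbol of the language of sums. -/
def sideSymbol (τ : FirstOrder.Language.{u, v}) {k : ℕ} (S : SideRel k) :
    (sumLanguage τ).Relations k :=
  Sum.inr S

/-- A relation symbol of `τ`, as a symbol of the language of sums. -/
def baseSymbol {k : ℕ} (R : τ.Relations k) : (sumLanguage τ).Relations k := Sum.inl R

/-- Up to isomorphism, `N` is the sum of `N₁` and `N₂`. -/
structure IsSum (τ : FirstOrder.Language.{u, v}) {N N₁ N₂ : Type*} [(sumLanguage τ).Structure N]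
    [τ.Structure N₁] [τ.Structure N₂] (i₁ : N₁ → N) (i₂ : N₂ → N) : Prop where
  inj₁ : Function.Injective i₁
  inj₂ : Function.Injective i₂
  ne : ∀ x y, i₁ x ≠ i₂ y
  cover : ∀ z, (∃ x, i₁ x = z) ∨ ∃ y, i₂ y = z
  rel : ∀ {k : ℕ} (R : τ.Relations k) (x : Fin k → N), RelMap (baseSymbol R) x ↔
    (∃ y : Fin k → N₁, (∀ i, x i = i₁ (y i)) ∧ RelMap R y) ∨
      ∃ y : Fin k → N₂, (∀ i, x i = i₂ (y i)) ∧ RelMap R y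
  left : ∀ x : Fin 1 → N, RelMap (sideSymbol τ SideRel.left) x ↔ ∃ a, x 0 = i₁ a
  right : ∀ x : Fin 1 → N, RelMap (sideSymbol τ SideRel.right) x ↔ ∃ a, x 0 = i₂ a

theorem isSum_inl_inr [τ.IsRelational] (M₁ : Type w₁) (M₂ : Type w₂) [τ.Structure M₁] [τ.Structure M₂] :
    IsSum τ (N := DisjointSum M₁ M₂) (Sum.inl : M₁ → M₁ ⊕ M₂) (Sum.inr : M₂ → M₁ ⊕ M₂) where
  inj₁ := Sum.inl_injective
  inj₂ := Sum.inr_injective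
  ne := fun _ _ => Sum.inl_ne_inr
  cover := fun z => by
    rcases z with x | y
    exacts [Or.inl ⟨x, rfl⟩, Or.inr ⟨y, rfl⟩]
  rel := fun _ _ => Iff.rfl
  left := fun _ => Iff.rfl
  right := fun _ => Iff.rfl

section Decomposition

variable {β β₁ β₂ : Type*}

/-- One of the pairs of formulas in a list is satisfied. -/
def HoldsList {N₁ N₂ : Type*} [τ.Structure N₁] [τ.Structure N₂]
    (Θ : List (τ.Formula β₁ × τ.Formula β₂)) (v₁ : β₁ → N₁) (v₂ : β₂ → N₂) : Prop :=
  ∃ p ∈ Θ, p.1.Realize v₁ ∧ p.2.Realize v₂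

/-- The negation of a disjunction of pairs of formulas. -/
def negList : List (τ.Formula β₁ × τ.Formula β₂) → List (τ.Formula β₁ × τ.Formula β₂)
  | [] => [(⊤, ⊤)]
  | p :: Θ => (negList Θ).flatMap fun q => [(p.1.not ⊓ q.1, q.2), (q.1, p.2.not ⊓ q.2)]

/-- Quantification over the distinguished variable. -/
noncomputable def existsNone (φ : τ.Formula (Option β)) : τ.Formula β :=
  Formula.iExs Unit (φ.relabel fun o => o.elim (Sum.inr ()) Sum.inl)

theorem realize_existsNone {N : Type*} [τ.Structure N] {φ : τ.Formula (Option β)} {x : β → N} :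
    (existsNone φ).Realize x ↔ ∃ a, φ.Realize fun o : Option β => o.elim a x := by
  unfold existsNone
  rw [Formula.realize_iExs]
  constructor
  · rintro ⟨i, hi⟩
    rw [Formula.realize_relabel] at hi
    refine ⟨i (), ?_⟩
    convert hi using 1
    funext o
    cases o <;> rfl
  · rintro ⟨a, ha⟩
    refine ⟨fun _ => a, ?_⟩
    rw [Formula.realize_relabel]
    convert ha using 1
    funext o
    cases o <;> rfl

open Classical in
/-- The pairs of formulas for a relation symbol of `τ` and given variables. -/
noncomputable def relList {k : ℕ} (R : τ.Relations k) (x : Fin k → β₁ ⊕ β₂) :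
    List (τ.Formula β₁ × τ.Formula β₂) :=
  (if h : ∀ i, ∃ a, x i = Sum.inl a then [(R.formula fun i => Term.var (h i).choose, ⊤)] else []) ++
    if h : ∀ i, ∃ a, x i = Sum.inr a then [(⊤, R.formula fun i => Term.var (h i).choose)] else []

/-- The pairs of formulas for an equation. -/
def eqList : β₁ ⊕ β₂ → β₁ ⊕ β₂ → List (τ.Formula β₁ × τ.Formula β₂)
  | .inl a, .inl b => [(Term.equal (Term.var a) (Term.var b), ⊤)]
  | .inr a, .inr b => [(⊤, Term.equal (Term.var a) (Term.var b))]
  | _, _ => []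

/-- The pairs of formulas for the predicates `L` and `R`. -/
def sideList {k : ℕ} : SideRel k → (Fin k → β₁ ⊕ β₂) → List (τ.Formula β₁ × τ.Formula β₂)
  | .left, x => (x 0).elim (fun _ => [(⊤, ⊤)]) fun _ => []
  | .right, x => (x 0).elim (fun _ => []) fun _ => [(⊤, ⊤)]

variable {N₁ N₂ : Type*} [τ.Structure N₁] [τ.Structure N₂]

theorem holdsList_negList {Θ : List (τ.Formula β₁ × τ.Formula β₂)} {v₁ : β₁ → N₁} {v₂ : β₂ → N₂} :
    HoldsList (negList Θ) v₁ v₂ ↔ ¬ HoldsList Θ v₁ v₂ := by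
  induction Θ with
  | nil => simp [HoldsList, negList]
  | cons p Θ ih =>
    have h1 : HoldsList (p :: Θ) v₁ v₂ ↔
        (p.1.Realize v₁ ∧ p.2.Realize v₂) ∨ HoldsList Θ v₁ v₂ := by simp [HoldsList]
    have h2 : HoldsList (negList (p :: Θ)) v₁ v₂ ↔
        ¬ (p.1.Realize v₁ ∧ p.2.Realize v₂) ∧ HoldsList (negList Θ) v₁ v₂ := by
      simp only [HoldsList, negList, List.mem_flatMap, List.mem_cons, List.not_mem_nil, or_false]
      constructor
      · rintro ⟨q, ⟨r, hr, rfl | rfl⟩, h⟩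
        · simp only [Formula.realize_inf, Formula.realize_not] at h
          exact ⟨fun h' => h.1.1 h'.1, r, hr, h.1.2, h.2⟩
        · simp only [Formula.realize_inf, Formula.realize_not] at h
          exact ⟨fun h' => h.2.1 h'.2, r, hr, h.1, h.2.2⟩
      · rintro ⟨h, r, hr, h3, h4⟩
        by_cases h5 : p.1.Realize v₁
        · refine ⟨_, ⟨r, hr, Or.inr rfl⟩, h3, ?_⟩
          simp only [Formula.realize_inf, Formula.realize_not]
          exact ⟨fun h6 => h ⟨h5, h6⟩, h4⟩
        · refine ⟨_, ⟨r, hr, Or.inl rfl⟩, ?_, h4⟩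
          simp only [Formula.realize_inf, Formula.realize_not]
          exact ⟨h5, h3⟩
    rw [h1, h2, ih, not_or]

theorem holdsList_append {Θ Θ' : List (τ.Formula β₁ × τ.Formula β₂)} {v₁ : β₁ → N₁}
    {v₂ : β₂ → N₂} :
    HoldsList (Θ ++ Θ') v₁ v₂ ↔ HoldsList Θ v₁ v₂ ∨ HoldsList Θ' v₁ v₂ := by
  simp [HoldsList, or_and_right, exists_or]

theorem realize_relList {N : Type*} [(sumLanguage τ).Structure N] {i₁ : N₁ → N} {i₂ : N₂ → N}
    (hN : IsSum τ i₁ i₂) {k : ℕ} (R : τ.Relations k) (x : Fin k → β₁ ⊕ β₂) (v₁ : β₁ → N₁)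
    (v₂ : β₂ → N₂) :
    RelMap (baseSymbol R) (fun i => Sum.elim (i₁ ∘ v₁) (i₂ ∘ v₂) (x i)) ↔
      HoldsList (relList R x) v₁ v₂ := by
  rw [hN.rel, relList, holdsList_append]
  refine or_congr ⟨?_, ?_⟩ ⟨?_, ?_⟩
  · rintro ⟨y, hy, hR⟩
    have h : ∀ i, ∃ a, x i = Sum.inl a := fun i => by
      have := hy i
      rcases hx : x i with a | a
      · exact ⟨a, rfl⟩
      · rw [hx] at this
        exact absurd this.symm (hN.ne _ _)
    rw [dif_pos h]
    refine ⟨_, List.mem_singleton.2 rfl, ?_, by simp⟩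
    rw [Formula.realize_rel]
    convert hR using 2 with i
    exact hN.inj₁
      ((congrArg (Sum.elim (i₁ ∘ v₁) (i₂ ∘ v₂)) (h i).choose_spec).symm.trans (hy i))
  · by_cases h : ∀ i, ∃ a, x i = Sum.inl a
    · rw [dif_pos h]
      rintro ⟨p, hp, hR, -⟩
      rw [List.mem_singleton.1 hp, Formula.realize_rel] at hR
      exact ⟨_, fun i => congrArg (Sum.elim (i₁ ∘ v₁) (i₂ ∘ v₂)) (h i).choose_spec, hR⟩
    · rw [dif_neg h]
      rintro ⟨p, hp, -⟩
      exact absurd hp List.not_mem_nil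
  · rintro ⟨y, hy, hR⟩
    have h : ∀ i, ∃ a, x i = Sum.inr a := fun i => by
      have := hy i
      rcases hx : x i with a | a
      · rw [hx] at this
        exact absurd this (hN.ne _ _)
      · exact ⟨a, rfl⟩
    rw [dif_pos h]
    refine ⟨_, List.mem_singleton.2 rfl, by simp, ?_⟩
    rw [Formula.realize_rel]
    convert hR using 2 with i
    exact hN.inj₂
      ((congrArg (Sum.elim (i₁ ∘ v₁) (i₂ ∘ v₂)) (h i).choose_spec).symm.trans (hy i))
  · by_cases h : ∀ i, ∃ a, x i = Sum.inr a
    · rw [dif_pos h]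
      rintro ⟨p, hp, -, hR⟩
      rw [List.mem_singleton.1 hp, Formula.realize_rel] at hR
      exact ⟨_, fun i => congrArg (Sum.elim (i₁ ∘ v₁) (i₂ ∘ v₂)) (h i).choose_spec, hR⟩
    · rw [dif_neg h]
      rintro ⟨p, hp, -⟩
      exact absurd hp List.not_mem_nil

theorem realize_sideList {N : Type*} [(sumLanguage τ).Structure N] {i₁ : N₁ → N} {i₂ : N₂ → N}
    (hN : IsSum τ i₁ i₂) {k : ℕ} (R : SideRel k) (x : Fin k → β₁ ⊕ β₂) (v₁ : β₁ → N₁)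
    (v₂ : β₂ → N₂) :
    RelMap (sideSymbol τ R)
        (fun i => Sum.elim (i₁ ∘ v₁) (i₂ ∘ v₂) (x i)) ↔
      HoldsList (sideList R x : List (τ.Formula β₁ × τ.Formula β₂)) v₁ v₂ := by
  cases R with
  | left =>
    refine (hN.left _).trans ?_
    rcases hx : x 0 with a | a <;> simp [sideList, HoldsList, hx, (hN.ne _ _).symm]
  | right =>
    refine (hN.right _).trans ?_
    rcases hx : x 0 with a | a <;> simp [sideList, HoldsList, hx, hN.ne]

variable [τ.IsRelational]

/-- A formula on a sum, with its variables assigned to the summands, is equivalent to a disjunction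
of conjunctions of a formula on the first and a formula on the second summand. -/
noncomputable def decompose {α : Type*} : ∀ {n : ℕ}, (sumLanguage τ).BoundedFormula α n →
    ∀ {β₁ β₂ : Type w₁}, (α → β₁ ⊕ β₂) → (Fin n → β₁ ⊕ β₂) →
      List (τ.Formula β₁ × τ.Formula β₂)
  | _, .falsum, _, _, _, _ => []
  | _, .equal t s, _, _, c, d => eqList (Sum.elim c d (termVar t)) (Sum.elim c d (termVar s))
  | _, .rel R ts, _, _, c, d =>
    Sum.elim (fun R => relList R fun i => Sum.elim c d (termVar (ts i)))
      (fun R => sideList R fun i => Sum.elim c d (termVar (ts i))) R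
  | _, .imp φ ψ, _, _, c, d => negList (decompose φ c d) ++ decompose ψ c d
  -- `∀` is treated as `¬∃¬`. The witness lies on one side, and since `∃` commutes with disjunction
  -- it only affects the component of that side.
  | _, .all φ, _, _, c, d =>
    negList
      ((negList (decompose φ (Sum.map some id ∘ c)
          (Fin.snoc (Sum.map some id ∘ d) (Sum.inl none)))).map
            (fun p => (existsNone p.1, p.2)) ++
        (negList (decompose φ (Sum.map id some ∘ c)
          (Fin.snoc (Sum.map id some ∘ d) (Sum.inr none)))).map
            fun p => (p.1, existsNone p.2))

theorem realize_decompose {N : Type*} [(sumLanguage τ).Structure N] {i₁ : N₁ → N} {i₂ : N₂ → N}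
    (hN : IsSum τ i₁ i₂) {α : Type*} {n : ℕ} (φ : (sumLanguage τ).BoundedFormula α n) :
    ∀ {β₁ β₂ : Type w₁} (c : α → β₁ ⊕ β₂) (d : Fin n → β₁ ⊕ β₂) (v₁ : β₁ → N₁) (v₂ : β₂ → N₂),
      φ.Realize (Sum.elim (i₁ ∘ v₁) (i₂ ∘ v₂) ∘ c) (Sum.elim (i₁ ∘ v₁) (i₂ ∘ v₂) ∘ d) ↔
        HoldsList (decompose φ c d) v₁ v₂ := by
  induction φ with
  | falsum => intros; simp [decompose, HoldsList, BoundedFormula.Realize]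
  | equal t s =>
    intro β₁ β₂ c d v₁ v₂
    simp only [BoundedFormula.Realize, realize_termVar, decompose, ← Sum.comp_elim,
      Function.comp_apply]
    generalize Sum.elim c d (termVar t) = x
    generalize Sum.elim c d (termVar s) = y
    rcases x with x | x <;> rcases y with y | y
    · simp [eqList, HoldsList, hN.inj₁.eq_iff]
    · simp [eqList, HoldsList, hN.ne]
    · simp [eqList, HoldsList, (hN.ne _ _).symm]
    · simp [eqList, HoldsList, hN.inj₂.eq_iff]
  | rel R ts =>
    intro β₁ β₂ c d v₁ v₂
    simp only [BoundedFormula.Realize, realize_termVar, decompose, ← Sum.comp_elim,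
      Function.comp_apply]
    rcases R with R | R
    · exact realize_relList hN R (fun i => Sum.elim c d (termVar (ts i))) v₁ v₂
    · exact realize_sideList hN R (fun i => Sum.elim c d (termVar (ts i))) v₁ v₂
  | imp φ ψ ihφ ihψ =>
    intro β₁ β₂ c d v₁ v₂
    rw [BoundedFormula.realize_imp, ihφ, ihψ]
    rw [decompose, holdsList_append, holdsList_negList, imp_iff_not_or]
  | all φ ih =>
    intro β₁ β₂ c d v₁ v₂
    rw [BoundedFormula.realize_all, decompose, holdsList_negList, holdsList_append, not_or]
    have hl : ∀ a : N₁, (φ.Realize (Sum.elim (i₁ ∘ v₁) (i₂ ∘ v₂) ∘ c)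
        (Fin.snoc (Sum.elim (i₁ ∘ v₁) (i₂ ∘ v₂) ∘ d) (i₁ a)) ↔
          HoldsList (decompose φ (Sum.map some id ∘ c)
            (Fin.snoc (Sum.map some id ∘ d) (Sum.inl none))) (fun o => o.elim a v₁) v₂) := by
      intro a
      rw [← ih]
      have h0 : Sum.elim (i₁ ∘ fun o : Option β₁ => o.elim a v₁) (i₂ ∘ v₂) ∘ Sum.map some id =
          Sum.elim (i₁ ∘ v₁) (i₂ ∘ v₂) := by
        funext z
        rcases z with z | z <;> rfl
      rw [Fin.comp_snoc, ← Function.comp_assoc, ← Function.comp_assoc, h0]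
      rfl
    have hr : ∀ a : N₂, (φ.Realize (Sum.elim (i₁ ∘ v₁) (i₂ ∘ v₂) ∘ c)
        (Fin.snoc (Sum.elim (i₁ ∘ v₁) (i₂ ∘ v₂) ∘ d) (i₂ a)) ↔
          HoldsList (decompose φ (Sum.map id some ∘ c)
            (Fin.snoc (Sum.map id some ∘ d) (Sum.inr none))) v₁ (fun o => o.elim a v₂)) := by
      intro a
      rw [← ih]
      have h0 : Sum.elim (i₁ ∘ v₁) (i₂ ∘ fun o : Option β₂ => o.elim a v₂) ∘ Sum.map id some =
          Sum.elim (i₁ ∘ v₁) (i₂ ∘ v₂) := by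
        funext z
        rcases z with z | z <;> rfl
      rw [Fin.comp_snoc, ← Function.comp_assoc, ← Function.comp_assoc, h0]
      rfl
    have hL : ∀ Θ : List (τ.Formula (Option β₁) × τ.Formula β₂),
        HoldsList (Θ.map fun p => (existsNone p.1, p.2)) v₁ v₂ ↔
          ∃ a, HoldsList Θ (fun o : Option β₁ => o.elim a v₁) v₂ := fun Θ => by
      simp only [HoldsList, List.mem_map, exists_exists_and_eq_and, realize_existsNone]
      exact ⟨fun ⟨p, hp, ⟨a, ha⟩, h⟩ => ⟨a, p, hp, ha, h⟩,
        fun ⟨a, p, hp, ha, h⟩ => ⟨p, hp, ⟨a, ha⟩, h⟩⟩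
    have hR : ∀ Θ : List (τ.Formula β₁ × τ.Formula (Option β₂)),
        HoldsList (Θ.map fun p => (p.1, existsNone p.2)) v₁ v₂ ↔
          ∃ a, HoldsList Θ v₁ (fun o : Option β₂ => o.elim a v₂) := fun Θ => by
      simp only [HoldsList, List.mem_map, exists_exists_and_eq_and, realize_existsNone]
      exact ⟨fun ⟨p, hp, h, ⟨a, ha⟩⟩ => ⟨a, p, hp, h, ha⟩,
        fun ⟨a, p, hp, h, ha⟩ => ⟨p, hp, h, ⟨a, ha⟩⟩⟩
    rw [hL, hR]
    simp only [holdsList_negList, not_exists, not_not, ← hl, ← hr]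
    constructor
    · exact fun h => ⟨fun a => h _, fun a => h _⟩
    · rintro ⟨h1, h2⟩ z
      rcases hN.cover z with ⟨a, rfl⟩ | ⟨a, rfl⟩
      exacts [h1 a, h2 a]

end Decomposition

end FefermanVaught

/-! ### Relativization of formulas to one side. -/

section Relativization

open FirstOrder.Language FirstOrder.Language.Structure FirstOrder.Language.Theory

variable {τ : FirstOrder.Language.{u, v}}

/-- Tuples of sums satisfy the same formulas if their parts in the summands do. -/
theorem IsSum.eqTp [τ.IsRelational] {N N₁ N₂ N' N₁' N₂' : Type*} [(sumLanguage τ).Structure N]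
    [τ.Structure N₁] [τ.Structure N₂] [(sumLanguage τ).Structure N'] [τ.Structure N₁']
    [τ.Structure N₂'] {i₁ : N₁ → N} {i₂ : N₂ → N} {i₁' : N₁' → N'} {i₂' : N₂' → N'}
    (hN : IsSum τ i₁ i₂) (hN' : IsSum τ i₁' i₂') {α : Type*} {β₁ β₂ : Type w₁} {v₁ : β₁ → N₁}
    {v₂ : β₂ → N₂} {v₁' : β₁ → N₁'} {v₂' : β₂ → N₂'} (h₁ : EqTp τ v₁ v₁') (h₂ : EqTp τ v₂ v₂')
    {x : α → N} {x' : α → N'} (c : α → β₁ ⊕ β₂)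
    (hx : ∀ a, x a = Sum.elim (i₁ ∘ v₁) (i₂ ∘ v₂) (c a))
    (hx' : ∀ a, x' a = Sum.elim (i₁' ∘ v₁') (i₂' ∘ v₂') (c a)) :
    EqTp (sumLanguage τ) x x' := by
  intro φ
  have h := realize_decompose hN φ c Fin.elim0 v₁ v₂
  have h' := realize_decompose hN' φ c Fin.elim0 v₁' v₂'
  rw [show x = Sum.elim (i₁ ∘ v₁) (i₂ ∘ v₂) ∘ c from funext hx,
    show x' = Sum.elim (i₁' ∘ v₁') (i₂' ∘ v₂') ∘ c from funext hx']
  unfold Formula.Realize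
  rw [Subsingleton.elim default (Sum.elim (i₁ ∘ v₁) (i₂ ∘ v₂) ∘ Fin.elim0), h,
    Subsingleton.elim default (Sum.elim (i₁' ∘ v₁') (i₂' ∘ v₂') ∘ Fin.elim0), h']
  exact exists_congr fun p => and_congr_right fun _ => and_congr (h₁ _) (h₂ _)

/-- The map `j` identifies `N₁` with the part of `N` given by a side; `z` tells which relations
without arguments hold in `N₁`. -/
structure IsSide (side : SideRel 1) (z : τ.Relations 0 → Prop) {N N₁ : Type*}
    [(sumLanguage τ).Structure N] [τ.Structure N₁] (j : N₁ → N) : Prop where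
  inj : Function.Injective j
  range : ∀ x : Fin 1 → N, RelMap (sideSymbol τ side) x ↔ ∃ a, x 0 = j a
  rel : ∀ {k : ℕ} (R : τ.Relations (k + 1)) (y : Fin (k + 1) → N₁),
    RelMap (baseSymbol R) (j ∘ y) ↔ RelMap R y
  -- A sum records only the disjunction of the two truth values of a nullary relation, so the value
  -- on one side has to be supplied by `z`.
  rel_zero : ∀ (R : τ.Relations 0) (y : Fin 0 → N₁), RelMap R y ↔ z R

theorem IsSum.isSide_left {N N₁ N₂ : Type*} [(sumLanguage τ).Structure N]
    [τ.Structure N₁] [τ.Structure N₂] {i₁ : N₁ → N} {i₂ : N₂ → N} (hN : IsSum τ i₁ i₂)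
    {z : τ.Relations 0 → Prop} (hz : ∀ (R : τ.Relations 0) (y : Fin 0 → N₁), RelMap R y ↔ z R) :
    IsSide SideRel.left z i₁ where
  inj := hN.inj₁
  range := hN.left
  rel := fun R y => by
    rw [hN.rel]
    constructor
    · rintro (⟨y', hy, h⟩ | ⟨y', hy, h⟩)
      · rwa [show y = y' from funext fun i => hN.inj₁ (hy i)]
      · exact absurd (hy 0) (hN.ne _ _)
    · exact fun h => Or.inl ⟨y, fun _ => rfl, h⟩
  rel_zero := hz

theorem IsSum.isSide_right {N N₁ N₂ : Type*} [(sumLanguage τ).Structure N]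
    [τ.Structure N₁] [τ.Structure N₂] {i₁ : N₁ → N} {i₂ : N₂ → N} (hN : IsSum τ i₁ i₂)
    {z : τ.Relations 0 → Prop} (hz : ∀ (R : τ.Relations 0) (y : Fin 0 → N₂), RelMap R y ↔ z R) :
    IsSide SideRel.right z i₂ where
  inj := hN.inj₂
  range := hN.right
  rel := fun R y => by
    rw [hN.rel]
    constructor
    · rintro (⟨y', hy, h⟩ | ⟨y', hy, h⟩)
      · exact absurd (hy 0).symm (hN.ne _ _)
      · rwa [show y = y' from funext fun i => hN.inj₂ (hy i)]
    · exact fun h => Or.inr ⟨y, fun _ => rfl, h⟩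
  rel_zero := hz

open Classical in
/-- A relation symbol applied to variables, interpreted in one side. -/
noncomputable def relativizeRel (z : τ.Relations 0 → Prop) {α : Type*} {n : ℕ} :
    ∀ {k : ℕ}, τ.Relations k → (Fin k → α ⊕ Fin n) → (sumLanguage τ).BoundedFormula α n
  | 0, R, _ => if z R then ⊤ else ⊥
  | _ + 1, R, x => (baseSymbol R).boundedFormula fun i => Term.var (x i)

/-- The relativization of a formula to one side. -/
noncomputable def relativize [τ.IsRelational] (side : SideRel 1) (z : τ.Relations 0 → Prop)
    {α : Type*} : ∀ {n : ℕ}, τ.BoundedFormula α n → (sumLanguage τ).BoundedFormula α n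
  | _, .falsum => .falsum
  | _, .equal t s => .equal (Term.var (termVar t)) (Term.var (termVar s))
  | _, .rel R ts => relativizeRel z R fun i => termVar (ts i)
  | _, .imp φ ψ => .imp (relativize side z φ) (relativize side z ψ)
  | n, .all φ => .all (.imp
      ((sideSymbol τ side).boundedFormula fun _ => Term.var (Sum.inr (Fin.last n)))
      (relativize side z φ))

variable {side : SideRel 1} {z : τ.Relations 0 → Prop} {N N₁ : Type*}
  [(sumLanguage τ).Structure N] [τ.Structure N₁] {j : N₁ → N}

theorem IsSide.realize_relativize [τ.IsRelational] (hj : IsSide side z j) {α : Type*} {n : ℕ}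
    (φ : τ.BoundedFormula α n) (x : α → N₁) (xs : Fin n → N₁) :
    (relativize side z φ).Realize (j ∘ x) (j ∘ xs) ↔ φ.Realize x xs := by
  induction φ with
  | falsum => exact Iff.rfl
  | equal t s =>
    simp only [relativize, BoundedFormula.Realize, realize_termVar, ← Sum.comp_elim,
      Function.comp_apply, hj.inj.eq_iff]
    exact Iff.rfl
  | @rel n k R ts =>
    cases k with
    | zero =>
      simp only [relativize, relativizeRel, BoundedFormula.Realize, hj.rel_zero]
      split_ifs with h <;> simp [h]
    | succ k =>
      simp only [relativize, relativizeRel, BoundedFormula.realize_rel, realize_termVar,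
        ← Sum.comp_elim]
      refine Iff.trans (hj.rel R fun i => Sum.elim x xs (termVar (ts i))) ?_
      simp only [BoundedFormula.Realize, realize_termVar]
  | imp φ ψ ihφ ihψ =>
    rw [relativize, BoundedFormula.realize_imp, BoundedFormula.realize_imp, ihφ, ihψ]
  | all φ ih =>
    rw [relativize, BoundedFormula.realize_all, BoundedFormula.realize_all]
    have h : ∀ b, (BoundedFormula.Realize ((sideSymbol τ side).boundedFormula
        fun _ => Term.var (Sum.inr (Fin.last _))) (j ∘ x) (Fin.snoc (j ∘ xs) b)) ↔
          ∃ a, b = j a := fun b => by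
      rw [BoundedFormula.realize_rel, hj.range]
      simp
    constructor
    · intro h1 a
      have := h1 (j a)
      rw [BoundedFormula.realize_imp, h, ← Fin.comp_snoc, ih] at this
      exact this ⟨a, rfl⟩
    · intro h1 b
      rw [BoundedFormula.realize_imp, h]
      rintro ⟨a, rfl⟩
      rw [← Fin.comp_snoc, ih]
      exact h1 a

theorem IsSide.eqTp [τ.IsRelational] (hj : IsSide side z j) {N' N₁' : Type*}
    [(sumLanguage τ).Structure N'] [τ.Structure N₁'] {j' : N₁' → N'} (hj' : IsSide side z j')
    {α : Type*} {x : α → N₁} {x' : α → N₁'} (h : EqTp (sumLanguage τ) (j ∘ x) (j' ∘ x')) :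
    EqTp τ x x' := by
  intro φ
  have h1 := hj.realize_relativize φ x default
  have h2 := hj'.realize_relativize φ x' default
  rw [Subsingleton.elim (j ∘ default) default] at h1
  rw [Subsingleton.elim (j' ∘ default) default] at h2
  exact h1.symm.trans ((h (relativize side z φ)).trans h2)

/-- A part of a structure, with the given truth values of relations without arguments. -/
@[reducible]
def sidePartStructure [τ.IsRelational] (side : SideRel 1) (z : τ.Relations 0 → Prop) :
    τ.Structure {x : N // RelMap (sideSymbol τ side) ![x]} where
  funMap f _ := isEmptyElim f
  RelMap {k} := match k with
    | 0 => fun R _ => z R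
    | _ + 1 => fun R y => RelMap (baseSymbol R) fun i => (y i : N)

theorem isSide_sidePart [τ.IsRelational] (side : SideRel 1) (z : τ.Relations 0 → Prop) :
    letI := sidePartStructure (N := N) side z
    IsSide side z (Subtype.val : {x : N // RelMap (sideSymbol τ side) ![x]} → N) := by
  let _ := sidePartStructure (N := N) side z
  refine ⟨Subtype.val_injective, fun x => ?_, fun R y => Iff.rfl, fun R y => Iff.rfl⟩
  have hx : x = ![x 0] := by
    ext i
    rw [Subsingleton.elim i 0]
    rfl
  constructor
  · intro h
    rw [hx] at h
    exact ⟨⟨x 0, h⟩, rfl⟩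
  · rintro ⟨a, ha⟩
    rw [hx, ha]
    exact a.2

end Relativization

/-! ### Models of the theory of a sum are sums of models. -/

section Models

open FirstOrder.Language FirstOrder.Language.Structure FirstOrder.Language.Theory

theorem eqTp_empty_iff {L : FirstOrder.Language.{u, v}} {M N : Type*} [L.Structure M]
    [L.Structure N] (x : Empty → M) (y : Empty → N) : EqTp L x y ↔ L.ElementarilyEquivalent M N := by
  rw [Subsingleton.elim x default, Subsingleton.elim y default]
  constructor
  · intro h
    rw [elementarilyEquivalent_iff]
    exact h
  · intro h φ
    exact h.realize_sentence φ

/-- Elementary equivalence is equality of types of the empty tuple, so a counterexample in `N` would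
be reflected in `M`. -/
theorem EqTp.forall_realize {L : FirstOrder.Language.{u, v}} {M N : Type*} [L.Structure M]
    [L.Structure N] [Nonempty M] (h : L.ElementarilyEquivalent M N) {α : Type*} (φ : L.Formula α)
    (hφ : ∀ x : α → M, φ.Realize x) (y : α → N) : φ.Realize y := by
  by_contra hy
  have h0 : EqTp L (Empty.elim : Empty → M) (Empty.elim : Empty → N) := (eqTp_empty_iff _ _).2 h
  obtain ⟨x, hx⟩ := h0.exists_realize (φ := φ.not.relabel Sum.inr) (z := y) (by
    rw [Formula.realize_relabel, Formula.realize_not]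
    exact hy)
  rw [Formula.realize_relabel, Formula.realize_not] at hx
  exact hx (hφ _)

theorem elementarilyEquivalent_of_model {L : FirstOrder.Language.{u, v}} (M : Type w₁)
    [L.Structure M] (N : ModelType.{u, v, max u v} (L.completeTheory M)) :
    L.ElementarilyEquivalent M N := by
  rw [elementarilyEquivalent_iff]
  exact fun φ => (realize_iff_of_model_completeTheory M N φ).symm

theorem model_completeTheory_of_elementarilyEquivalent {L : FirstOrder.Language.{u, v}} {M N : Type*}
    [L.Structure M] [L.Structure N] (h : L.ElementarilyEquivalent M N) :
    N ⊨ L.completeTheory M :=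
  h.theory_model_iff.1 inferInstance

theorem relMap_zero_iff {L : FirstOrder.Language.{u, v}} {M N : Type*} [L.Structure M]
    [L.Structure N] (h : L.ElementarilyEquivalent M N) (R : L.Relations 0) (x : Fin 0 → M)
    (y : Fin 0 → N) : RelMap R x ↔ RelMap R y := by
  have := h.realize_sentence (R.formula (Fin.elim0 : Fin 0 → L.Term Empty))
  simp only [Sentence.Realize, Formula.realize_rel] at this
  rwa [Subsingleton.elim x, Subsingleton.elim y]

variable {τ : FirstOrder.Language.{u, v}}

/-- The truth values of relations without arguments. -/
def zeroRel (M : Type w₁) [τ.Structure M] (R : τ.Relations 0) : Prop :=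
  RelMap R (default : Fin 0 → M)

theorem zeroRel_iff (M : Type w₁) [τ.Structure M] (N : ModelType.{u, v, max u v}
    (τ.completeTheory M)) (R : τ.Relations 0) (y : Fin 0 → N) :
    RelMap R y ↔ zeroRel M R := by
  exact (relMap_zero_iff (elementarilyEquivalent_of_model M N) R _ _).symm

variable [τ.IsRelational] {M₁ : Type w₁} {M₂ : Type w₂} [τ.Structure M₁] [τ.Structure M₂]

theorem exists_isSum (N₁ : ModelType.{u, v, max u v} (τ.completeTheory M₁))
    (N₂ : ModelType.{u, v, max u v} (τ.completeTheory M₂)) :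
    ∃ (N : ModelType.{u, v, max u v} ((sumLanguage τ).completeTheory (DisjointSum M₁ M₂)))
      (i₁ : N₁ → N) (i₂ : N₂ → N), IsSum τ i₁ i₂ := by
  have h : (sumLanguage τ).ElementarilyEquivalent (DisjointSum M₁ M₂) (DisjointSum N₁ N₂) := by
    rw [← eqTp_empty_iff Empty.elim Empty.elim]
    exact (isSum_inl_inr M₁ M₂).eqTp (isSum_inl_inr N₁ N₂)
      ((eqTp_empty_iff Empty.elim Empty.elim).2 (elementarilyEquivalent_of_model M₁ N₁))
      ((eqTp_empty_iff Empty.elim Empty.elim).2 (elementarilyEquivalent_of_model M₂ N₂))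
      Empty.elim (fun a => a.elim) fun a => a.elim
  have : DisjointSum N₁ N₂ ⊨ (sumLanguage τ).completeTheory (DisjointSum M₁ M₂) :=
    model_completeTheory_of_elementarilyEquivalent h
  have : Nonempty (DisjointSum N₁ N₂) := ⟨Sum.inl (Classical.arbitrary N₁)⟩
  exact ⟨ModelType.of _ (DisjointSum N₁ N₂), _, _, isSum_inl_inr N₁ N₂⟩

variable (M₁ M₂)

/-- Each model of the theory of a sum is a sum of models. -/
theorem exists_split [Nonempty M₁] [Nonempty M₂]
    (N : ModelType.{u, v, max u v} ((sumLanguage τ).completeTheory (DisjointSum M₁ M₂))) :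
    ∃ (N₁ : ModelType.{u, v, max u v} (τ.completeTheory M₁))
      (N₂ : ModelType.{u, v, max u v} (τ.completeTheory M₂)) (i₁ : N₁ → N) (i₂ : N₂ → N),
      IsSum τ i₁ i₂ := by
  have hM := isSum_inl_inr (τ := τ) M₁ M₂
  have : Nonempty (DisjointSum M₁ M₂) := ⟨Sum.inl (Classical.arbitrary M₁)⟩
  have hMN : (sumLanguage τ).ElementarilyEquivalent (DisjointSum M₁ M₂) N :=
    elementarilyEquivalent_of_model _ N
  have hz₁ : ∀ (R : τ.Relations 0) (y : Fin 0 → M₁), RelMap R y ↔ zeroRel M₁ R :=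
    fun R y => by rw [zeroRel, Subsingleton.elim y]
  have hz₂ : ∀ (R : τ.Relations 0) (y : Fin 0 → M₂), RelMap R y ↔ zeroRel M₂ R :=
    fun R y => by rw [zeroRel, Subsingleton.elim y]
  let _ := sidePartStructure (N := N) SideRel.left (zeroRel (τ := τ) M₁)
  let _ := sidePartStructure (N := N) SideRel.right (zeroRel (τ := τ) M₂)
  have hl := isSide_sidePart (N := N) SideRel.left (zeroRel (τ := τ) M₁)
  have hr := isSide_sidePart (N := N) SideRel.right (zeroRel (τ := τ) M₂)
  have hne : ∀ side : SideRel 1, (∃ x : DisjointSum M₁ M₂, RelMap (sideSymbol τ side) ![x]) →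
      Nonempty {x : N // RelMap (sideSymbol τ side) ![x]} := by
    intro side ⟨x, hx⟩
    by_contra hcon
    have := EqTp.forall_realize hMN.symm
      ((sideSymbol τ side).formula fun _ : Fin 1 => Term.var (0 : Fin 1)).not (fun y => by
        rw [Formula.realize_not, Formula.realize_rel]
        intro h
        refine hcon ⟨y 0, ?_⟩
        convert h using 1
        ext i
        rw [Subsingleton.elim i 0]
        rfl) fun _ => x
    rw [Formula.realize_not, Formula.realize_rel] at this
    refine this ?_
    convert hx using 1
    ext i
    rw [Subsingleton.elim i 0]
    rfl
  have hne₁ := hne SideRel.left ⟨Sum.inl (Classical.arbitrary M₁), _, rfl⟩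
  have hne₂ := hne SideRel.right ⟨Sum.inr (Classical.arbitrary M₂), _, rfl⟩
  have h0 : EqTp (sumLanguage τ) (Empty.elim : Empty → DisjointSum M₁ M₂)
      (Empty.elim : Empty → N) := (eqTp_empty_iff _ _).2 hMN
  have hm₁ : {x : N // RelMap (sideSymbol τ SideRel.left) ![x]} ⊨ τ.completeTheory M₁ := by
    refine model_completeTheory_of_elementarilyEquivalent ((eqTp_empty_iff Empty.elim Empty.elim).1
      ((hM.isSide_left hz₁).eqTp hl (h0.of_comp id (fun a => a.elim) fun a => a.elim)))
  have hm₂ : {x : N // RelMap (sideSymbol τ SideRel.right) ![x]} ⊨ τ.completeTheory M₂ := by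
    refine model_completeTheory_of_elementarilyEquivalent ((eqTp_empty_iff Empty.elim Empty.elim).1
      ((hM.isSide_right hz₂).eqTp hr (h0.of_comp id (fun a => a.elim) fun a => a.elim)))
  have hsides : ∀ x : N, (RelMap (sideSymbol τ SideRel.left) ![x] ∧
      ¬ RelMap (sideSymbol τ SideRel.right) ![x]) ∨ (¬ RelMap (sideSymbol τ SideRel.left) ![x] ∧
      RelMap (sideSymbol τ SideRel.right) ![x]) := by
    intro x
    have := EqTp.forall_realize hMN
      ((((sideSymbol τ SideRel.left).formula fun _ : Fin 1 => Term.var (0 : Fin 1)) ⊓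
        ((sideSymbol τ SideRel.right).formula fun _ : Fin 1 => Term.var (0 : Fin 1)).not) ⊔
      (((sideSymbol τ SideRel.left).formula fun _ : Fin 1 => Term.var (0 : Fin 1)).not ⊓
        ((sideSymbol τ SideRel.right).formula fun _ : Fin 1 => Term.var (0 : Fin 1)))) (by
      intro y
      simp only [Formula.realize_sup, Formula.realize_inf, Formula.realize_not,
        Formula.realize_rel, hM.left, hM.right, Term.realize_var]
      rcases hM.cover (y 0) with ⟨a, ha⟩ | ⟨a, ha⟩
      · exact Or.inl ⟨⟨a, ha.symm⟩, fun ⟨b, hb⟩ => hM.ne a b (ha.trans hb)⟩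
      · exact Or.inr ⟨fun ⟨b, hb⟩ => hM.ne b a (hb.symm.trans ha.symm), ⟨a, ha.symm⟩⟩) fun _ => x
    simp only [Formula.realize_sup, Formula.realize_inf, Formula.realize_not,
        Formula.realize_rel, Term.realize_var] at this
    have e : ![x] = fun _ : Fin 1 => x := by
      ext i
      simp
    rw [e]
    exact this
  have hsum : IsSum τ (N := N) (N₁ := {x : N // RelMap (sideSymbol τ SideRel.left) ![x]})
      (N₂ := {x : N // RelMap (sideSymbol τ SideRel.right) ![x]}) Subtype.val Subtype.val := by
    refine ⟨hl.inj, hr.inj, fun x y hxy => ?_, fun x => ?_, fun {k} R x => ?_, hl.range, hr.range⟩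
    · have hy := y.2
      rw [← hxy] at hy
      rcases hsides x with h | h
      exacts [h.2 hy, h.1 x.2]
    · rcases hsides x with h | h
      exacts [Or.inl ⟨⟨x, h.1⟩, rfl⟩, Or.inr ⟨⟨x, h.2⟩, rfl⟩]
    · cases k with
      | zero =>
        -- A nullary relation holds in `N` iff it holds in `M₁` or in `M₂`, and the sides were given
        -- the truth values of `M₁` and `M₂`.
        rw [← relMap_zero_iff hMN (baseSymbol R) Fin.elim0 x, hM.rel]
        refine or_congr ⟨?_, ?_⟩ ⟨?_, ?_⟩
        · exact fun ⟨y, _, h⟩ => ⟨Fin.elim0, fun i => i.elim0, (hz₁ R y).1 h⟩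
        · exact fun ⟨y, _, h⟩ => ⟨Fin.elim0, fun i => i.elim0, (hz₁ R _).2 h⟩
        · exact fun ⟨y, _, h⟩ => ⟨Fin.elim0, fun i => i.elim0, (hz₂ R y).1 h⟩
        · exact fun ⟨y, _, h⟩ => ⟨Fin.elim0, fun i => i.elim0, (hz₂ R _).2 h⟩
      | succ k =>
        constructor
        · intro hR
          -- That no related tuple mixes the two sides is first-order, hence inherited from the
          -- original sum.
          have := EqTp.forall_realize hMN
            ((((baseSymbol R).formula fun i : Fin (k + 1) => Term.var i)).imp
              ((Formula.iInf fun i : Fin (k + 1) => (sideSymbol τ SideRel.left).formula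
                fun _ : Fin 1 => Term.var i) ⊔
              (Formula.iInf fun i : Fin (k + 1) => (sideSymbol τ SideRel.right).formula
                fun _ : Fin 1 => Term.var i))) (by
            intro y
            simp only [Formula.realize_imp, Formula.realize_sup, Formula.realize_iInf,
              Formula.realize_rel, hM.left, hM.right, hM.rel, Term.realize_var]
            rintro (⟨y', hy', -⟩ | ⟨y', hy', -⟩)
            · exact Or.inl fun i => ⟨_, hy' i⟩
            · exact Or.inr fun i => ⟨_, hy' i⟩) x
          simp only [Formula.realize_imp, Formula.realize_sup, Formula.realize_iInf,
            Formula.realize_rel, hl.range, hr.range, Term.realize_var] at this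
          rcases this hR with h | h <;> choose y hy using h
          · refine Or.inl ⟨y, hy, (hl.rel R y).1 ?_⟩
            rwa [show Subtype.val ∘ y = x from funext fun i => (hy i).symm]
          · refine Or.inr ⟨y, hy, (hr.rel R y).1 ?_⟩
            rwa [show Subtype.val ∘ y = x from funext fun i => (hy i).symm]
        · rintro (⟨y, hy, h⟩ | ⟨y, hy, h⟩)
          · rw [show x = Subtype.val ∘ y from funext hy]
            exact (hl.rel R y).2 h
          · rw [show x = Subtype.val ∘ y from funext hy]
            exact (hr.rel R y).2 h
  exact ⟨ModelType.of _ {x : N // RelMap (sideSymbol τ SideRel.left) ![x]},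
    ModelType.of _ {x : N // RelMap (sideSymbol τ SideRel.right) ![x]}, _, _, hsum⟩

end Models

/-! ### Passing maps, configurations and forking between a sum and its sides. -/

section Transfer

open FirstOrder.Language FirstOrder.Language.Structure FirstOrder.Language.Theory

variable {τ : FirstOrder.Language.{u, v}}

section Side

variable {side : SideRel 1} {z : τ.Relations 0 → Prop} {N N₁ : Type*}
  [(sumLanguage τ).Structure N] [τ.Structure N₁] {j : N₁ → N}

/-- Elementary maps preserve the predicates `L` and `R`, hence the sides; the restriction is
elementary by relativization. -/
theorem IsSide.exists_restrict [τ.IsRelational] (hj : IsSide side z j) {N' N₁' : Type*}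
    [(sumLanguage τ).Structure N'] [τ.Structure N₁'] {j' : N₁' → N'} (hj' : IsSide side z j')
    (g : N ↪ₑ[sumLanguage τ] N') : ∃ g₁ : N₁ ↪ₑ[τ] N₁', ∀ x, j' (g₁ x) = g (j x) := by
  have h : ∀ x, ∃ a, g (j x) = j' a := fun x => by
    have h1 := (hj.range fun _ => j x).2 ⟨x, rfl⟩
    have h2 := (g.map_rel (sideSymbol τ side) fun _ => j x).2 h1
    exact (hj'.range _).1 h2
  choose g₁ hg₁ using h
  have h2 : EqTp (sumLanguage τ) (j' ∘ g₁) (j ∘ id) := by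
    rw [show j' ∘ g₁ = g ∘ j from funext fun x => (hg₁ x).symm]
    exact eqTp_embedding g j
  obtain ⟨g₂, hg₂⟩ := (hj'.eqTp hj h2).exists_embedding
  exact ⟨g₂, fun x => by rw [hg₂, hg₁]⟩

theorem IsSide.exists_eq_of_eqTp (hj : IsSide side z j) {N' N₁' : Type*}
    [(sumLanguage τ).Structure N'] [τ.Structure N₁'] {j' : N₁' → N'} (hj' : IsSide side z j')
    {α : Type*} {x : α → N} {y : α → N'} (h : EqTp (sumLanguage τ) x y) {i : α}
    (hi : ∃ a, x i = j a) : ∃ a, y i = j' a := by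
  have := h ((sideSymbol τ side).formula fun _ => Term.var i)
  simp only [Formula.realize_rel, hj.range, hj'.range, Term.realize_var] at this
  exact this.1 hi

theorem IsSide.sameType [τ.IsRelational] (hj : IsSide side z j) {α β : Type} {D : Set N} {A : Set N₁}
    {x y : α → N} {x₁ y₁ : β → N₁} (h : SameType (sumLanguage τ) D x y) (hA : j '' A ⊆ D)
    (e : β → α) (hx : ∀ b, j (x₁ b) = x (e b)) (hy : ∀ b, j (y₁ b) = y (e b)) :
    SameType τ A x₁ y₁ := by
  have h1 := h.eqTp (fun a : A => j a) fun a => hA ⟨a, a.2, rfl⟩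
  refine hj.eqTp hj (h1.of_comp (Sum.map id e) ?_ ?_)
  · rintro (b | b) <;> simp [hx]
  · rintro (b | b) <;> simp [hy]

/-- The part of a configuration which lies in one side. -/
theorem Config.exists_side [τ.IsRelational] {ℓ : IctKind} {A : Set N} (hj : IsSide side z j)
    (S : Config (sumLanguage τ) ℓ A ℕ) :
    ∃ (S₁ : Config τ ℓ (j ⁻¹' A) ℕ) (e : S₁.κ → S.κ),
      (∀ t x, j (S₁.a t x) = S.a t (e x)) ∧
      (∀ t x, (∃ a, S.a t x = j a) → x ∈ Set.range e) ∧
      ∀ s i, ∀ a, j a ∈ S.params s i → a ∈ S₁.params s i := by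
  -- By indiscernibility the side of a coordinate does not depend on the index, so restricting to a
  -- side amounts to selecting coordinates.
  have ha : ∀ t t' x, (∃ a, S.a t x = j a) → ∃ a, S.a t' x = j a := by
    intro t t' x hx
    have := S.indisc 1 (OrderEmbedding.ofStrictMono (fun _ => t) (Subsingleton.strictMono _))
      (OrderEmbedding.ofStrictMono (fun _ => t') (Subsingleton.strictMono _))
    exact hj.exists_eq_of_eqTp hj this (i := Sum.inr (Sum.inl (0, x))) hx
  have hb : ∀ y η η', (∃ a, S.b y η = j a) → ∃ a, S.b y η' = j a := by
    intro y η η' hy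
    exact hj.exists_eq_of_eqTp hj (S.indisc _ η η')
      (i := Sum.inr (Sum.inr ⟨y, RelEmbedding.refl _⟩)) hy
  choose a₁ ha₁ using fun (x : {x // ∃ a, S.a 0 x = j a}) t => ha 0 t x x.2
  choose b₁ hb₁ using fun (y : {y // ∃ a, S.b y (Fin.valOrderEmb _) = j a}) η => hb y _ η y.2
  refine ⟨⟨{x // ∃ a, S.a 0 x = j a}, {y // ∃ a, S.b y (Fin.valOrderEmb _) = j a},
    ?_, ?_, fun y => S.len y, fun t x => a₁ x t, fun y η => b₁ y η, fun r f g => ?_, ?_⟩,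
    Subtype.val, fun t x => (ha₁ x t).symm, fun t x hx => ⟨⟨x, ha _ _ _ hx⟩, rfl⟩, ?_⟩
  · have := S.finite_κ
    infer_instance
  · have := S.finite_Y
    infer_instance
  · refine hj.sameType (S.indisc r f g) (Set.image_preimage_subset _ _)
      (Sum.map (fun x => (x.1, x.2.1)) fun y => ⟨y.1.1, y.2⟩) ?_ ?_
    all_goals
      rintro (x | y)
      · exact (ha₁ _ _).symm
      · exact (hb₁ _ _).symm
  · have had := S.adm
    cases ℓ with
    | one =>
      have : IsEmpty S.Y := had
      exact ⟨fun y => this.elim y.1⟩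
    | two =>
      rintro ⟨y, hy⟩
      obtain ⟨k, x, hx⟩ := had y
      refine ⟨k, ⟨x, ha _ _ _ (hx (Fin.valOrderEmb _) ▸ hy)⟩, fun η => hj.inj ?_⟩
      rw [← hb₁, ← ha₁]
      exact hx η
    | three => trivial
  · rintro s i a ⟨y, hy, η, hη, h⟩
    refine ⟨⟨y, hb _ _ _ ⟨a, h.symm⟩⟩, hy, η, hη, hj.inj ?_⟩
    exact h.trans (hb₁ ⟨y, _⟩ η)

end Side

/-- The relation `Q` between a model and two maps into it says that the model is a sum, the first
map being the inclusion of the part given by `side`. -/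
structure IsSumRelation (side : SideRel 1) (z : τ.Relations 0 → Prop) {T₁ T₂ : τ.Theory}
    {T : (sumLanguage τ).Theory} (Q : ∀ {N : ModelType.{u, v, max u v} T}
      {N₁ : ModelType.{u, v, max u v} T₁} {N₂ : ModelType.{u, v, max u v} T₂},
      (N₁ → N) → (N₂ → N) → Prop) : Prop where
  isSide : ∀ {N : ModelType.{u, v, max u v} T} {N₁ : ModelType.{u, v, max u v} T₁}
    {N₂ : ModelType.{u, v, max u v} T₂} {i₁ : N₁ → N} {i₂ : N₂ → N}, Q i₁ i₂ → IsSide side z i₁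
  cover : ∀ {N : ModelType.{u, v, max u v} T} {N₁ : ModelType.{u, v, max u v} T₁}
    {N₂ : ModelType.{u, v, max u v} T₂} {i₁ : N₁ → N} {i₂ : N₂ → N}, Q i₁ i₂ →
      ∀ x, (∃ a, i₁ a = x) ∨ ∃ b, i₂ b = x
  eqTp : ∀ {N N' : ModelType.{u, v, max u v} T} {N₁ N₁' : ModelType.{u, v, max u v} T₁}
    {N₂ N₂' : ModelType.{u, v, max u v} T₂} {i₁ : N₁ → N} {i₂ : N₂ → N} {i₁' : N₁' → N'}
    {i₂' : N₂' → N'}, Q i₁ i₂ → Q i₁' i₂' → ∀ {α β₁ β₂ : Type (max u v)} {v₁ : β₁ → N₁}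
    {v₂ : β₂ → N₂} {v₁' : β₁ → N₁'} {v₂' : β₂ → N₂'}, EqTp τ v₁ v₁' → EqTp τ v₂ v₂' →
    ∀ {x : α → N} {x' : α → N'} (c : α → β₁ ⊕ β₂),
    (∀ a, x a = Sum.elim (i₁ ∘ v₁) (i₂ ∘ v₂) (c a)) →
    (∀ a, x' a = Sum.elim (i₁' ∘ v₁') (i₂' ∘ v₂') (c a)) → EqTp (sumLanguage τ) x x'
  exists_sum : ∀ (N₁ : ModelType.{u, v, max u v} T₁) (N₂ : ModelType.{u, v, max u v} T₂),
    ∃ (N : ModelType.{u, v, max u v} T) (i₁ : N₁ → N) (i₂ : N₂ → N), Q i₁ i₂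
  exists_split : ∀ N : ModelType.{u, v, max u v} T, ∃ (N₁ : ModelType.{u, v, max u v} T₁)
    (N₂ : ModelType.{u, v, max u v} T₂) (i₁ : N₁ → N) (i₂ : N₂ → N), Q i₁ i₂

section SumRelation

variable {side : SideRel 1} {z : τ.Relations 0 → Prop} {T₁ T₂ : τ.Theory}
  {T : (sumLanguage τ).Theory} {Q : ∀ {N : ModelType.{u, v, max u v} T}
    {N₁ : ModelType.{u, v, max u v} T₁} {N₂ : ModelType.{u, v, max u v} T₂},
    (N₁ → N) → (N₂ → N) → Prop}
  {N N' : ModelType.{u, v, max u v} T} {N₁ N₁' : ModelType.{u, v, max u v} T₁}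
  {N₂ N₂' : ModelType.{u, v, max u v} T₂} {i₁ : N₁ → N} {i₂ : N₂ → N} {i₁' : N₁' → N'}
  {i₂' : N₂' → N'}

theorem IsSumRelation.exists_join (hQ : IsSumRelation side z Q) (h : Q i₁ i₂) (h' : Q i₁' i₂')
    (g₁ : N₁ ↪ₑ[τ] N₁') (g₂ : N₂ ↪ₑ[τ] N₂') :
    ∃ g : N ↪ₑ[sumLanguage τ] N', (∀ x, g (i₁ x) = i₁' (g₁ x)) ∧
      ∀ x, g (i₂ x) = i₂' (g₂ x) := by
  have hc : ∀ x, ∃ c : N₁ ⊕ N₂, x = Sum.elim i₁ i₂ c := fun x => by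
    rcases hQ.cover h x with ⟨a, rfl⟩ | ⟨a, rfl⟩
    exacts [⟨Sum.inl a, rfl⟩, ⟨Sum.inr a, rfl⟩]
  choose c hc using hc
  -- The enumerations of the two parts are appended to that of `N`, so that compatibility of `g`
  -- with `g₁` and `g₂` can be read off from equations in the type.
  have key := hQ.eqTp h h' (eqTp_embedding g₁ id).symm (eqTp_embedding g₂ id).symm
    (x := Sum.elim id (Sum.elim i₁ i₂)) (x' := Sum.elim (fun x => Sum.elim (i₁' ∘ g₁) (i₂' ∘ g₂)
      (c x)) (Sum.elim (i₁' ∘ g₁) (i₂' ∘ g₂))) (Sum.elim c id)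
      (by rintro (x | x | x); exacts [hc x, rfl, rfl]) (by rintro (x | x | x) <;> rfl)
  obtain ⟨g, hg⟩ := (key.symm.of_comp Sum.inl (x' := fun x => Sum.elim (i₁' ∘ g₁) (i₂' ∘ g₂) (c x))
    (y' := id) (fun _ => rfl) fun _ => rfl).exists_embedding
  refine ⟨g, fun x => ?_, fun x => ?_⟩
  · rw [hg]
    exact (key.eq_iff (Sum.inl (i₁ x)) (Sum.inr (Sum.inl x))).1 rfl
  · rw [hg]
    exact (key.eq_iff (Sum.inl (i₂ x)) (Sum.inr (Sum.inr x))).1 rfl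

theorem IsSumRelation.sameType (hQ : IsSumRelation side z Q) (h : Q i₁ i₂) {D : Set N}
    {A₁ : Set N₁} {A₂ : Set N₂} (hD : D ⊆ i₁ '' A₁ ∪ i₂ '' A₂) {α β₁ β₂ : Type} {x₁ y₁ : β₁ → N₁}
    {x₂ y₂ : β₂ → N₂} (h₁ : SameType τ A₁ x₁ y₁) (h₂ : SameType τ A₂ x₂ y₂) {x y : α → N}
    (c : α → β₁ ⊕ β₂) (hx : ∀ a, x a = Sum.elim (i₁ ∘ x₁) (i₂ ∘ x₂) (c a))
    (hy : ∀ a, y a = Sum.elim (i₁ ∘ y₁) (i₂ ∘ y₂) (c a)) : SameType (sumLanguage τ) D x y := by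
  have hd : ∀ d : D, ∃ c : A₁ ⊕ A₂, (d : N) = Sum.elim (fun a : A₁ => i₁ a) (fun a : A₂ => i₂ a) c :=
    fun d => by
      rcases hD d.2 with ⟨a, ha, h⟩ | ⟨a, ha, h⟩
      exacts [⟨Sum.inl ⟨a, ha⟩, h.symm⟩, ⟨Sum.inr ⟨a, ha⟩, h.symm⟩]
  choose d hd using hd
  refine hQ.eqTp h h h₁ h₂ (Sum.elim (fun x => Sum.map Sum.inl Sum.inl (d x))
    fun a => Sum.map Sum.inr Sum.inr (c a)) ?_ ?_
  · rintro (a | a)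
    · simp only [Sum.elim_inl, hd a]
      rcases d a with b | b <;> rfl
    · simp only [Sum.elim_inr, hx a]
      rcases c a with b | b <;> rfl
  · rintro (a | a)
    · simp only [Sum.elim_inl, hd a]
      rcases d a with b | b <;> rfl
    · simp only [Sum.elim_inr, hy a]
      rcases c a with b | b <;> rfl

/-- The image of a configuration in a sum. -/
def Config.lift {ℓ : IctKind} {A : Set N₁} (S : Config τ ℓ A ℕ) (hQ : IsSumRelation side z Q)
    (h : Q i₁ i₂) : Config (sumLanguage τ) ℓ (i₁ '' A) ℕ where
  κ := S.κ
  Y := S.Y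
  finite_κ := S.finite_κ
  finite_Y := S.finite_Y
  len := S.len
  a := fun t x => i₁ (S.a t x)
  b := fun y η => i₁ (S.b y η)
  indisc := fun r f g => by
    refine hQ.sameType h (A₂ := ∅) Set.subset_union_left (S.indisc r f g)
      (x₂ := Empty.elim) (y₂ := Empty.elim) (fun _ => Iff.rfl) Sum.inl ?_ ?_ <;>
      rintro (x | x) <;> rfl
  adm := by
    have had := S.adm
    cases ℓ with
    | one => exact had
    | two =>
      intro y
      obtain ⟨j, x, hx⟩ := had y
      exact ⟨j, x, fun η => congrArg i₁ (hx η)⟩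
    | three => trivial

/-- One model of `T₂` is added to every model of `T₁` involved. A realization of the transferred
type lies in the first part, because its type says so. It is distinguished there by a configuration,
and equality of types in the sum would give equality in the part, so the image of the configuration
distinguishes it in the sum. -/
theorem IsSumRelation.kappaIctGT [τ.IsRelational] (hQ : IsSumRelation side z Q) (hT₂ : T₂.IsSatisfiable)
    {ℓ : IctKind} (hκ : KappaIctGT ℓ T₁ ℵ₀) : KappaIctGT ℓ T ℵ₀ := by
  obtain ⟨N₁, B₁, m, P₁, f₀₁, c₀, hfork⟩ := hκ.exists_typeForks
  obtain ⟨N₂⟩ := hT₂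
  obtain ⟨N, i₁, i₂, hN⟩ := hQ.exists_sum N₁ N₂
  obtain ⟨P, j₁, j₂, hP⟩ := hQ.exists_sum P₁ N₂
  obtain ⟨f₀, hf₀, -⟩ := hQ.exists_join hN hP f₀₁ (ElementaryEmbedding.refl τ N₂)
  refine kappaIctGT_of_typeForks (M := 2) (B := i₁ '' B₁) (f₀ := f₀) (c₀ := j₁ ∘ c₀) (by norm_num)
    fun n A hA hfin => ?_
  obtain ⟨A₁, hA₁, rfl⟩ := Set.subset_image_iff.1 hA
  have hfin₁ : A₁.Finite := hfin.of_finite_image (hQ.isSide hN).inj.injOn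
  obtain ⟨N₁', f₁, hf₁⟩ := hfork 2 n A₁ le_rfl hA₁ hfin₁
  obtain ⟨N', i₁', i₂', hN'⟩ := hQ.exists_sum N₁' N₂
  obtain ⟨f, hf, -⟩ := hQ.exists_join hN hN' f₁ (ElementaryEmbedding.refl τ N₂)
  refine ⟨N', f, fun N'' g c hc => ?_⟩
  obtain ⟨N₁'', N₂'', k₁, k₂, hN''⟩ := hQ.exists_split N''
  obtain ⟨g₁, hg₁⟩ := (hQ.isSide hN').exists_restrict (hQ.isSide hN'') g
  have hc₁ : ∀ i, ∃ a, c i = k₁ a := fun i =>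
    (hQ.isSide hP).exists_eq_of_eqTp (hQ.isSide hN'') hc.symm (i := Sum.inr i) ⟨_, rfl⟩
  choose c₁ hc₁ using hc₁
  obtain ⟨S, t, ht, hd⟩ := hf₁ N₁'' g₁ c₁ (by
    refine (hQ.isSide hN'').eqTp (hQ.isSide hP) (hc.of_comp
      (Sum.map (fun b : B₁ => (⟨i₁ b, b, b.2, rfl⟩ : ↥(i₁ '' B₁))) id) ?_ ?_)
    · rintro (b | b)
      · simp [hf, hg₁]
      · simp [hc₁]
    · rintro (b | b)
      · simp [hf₀]
      · rfl)
  have hAA : f '' (i₁ '' A₁) = i₁' '' (f₁ '' A₁) := by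
    simp only [← Set.image_comp]
    exact Set.image_congr fun x _ => hf x
  rw [hAA]
  refine ⟨S.lift hQ hN', t, ht, fun i hi hsame => hd i hi ?_⟩
  refine (hQ.isSide hN'').sameType hsame ?_ id ?_ ?_
  · rw [← Set.image_comp, show k₁ ∘ g₁ = g ∘ i₁' from funext hg₁, Set.image_comp]
    refine Set.image_mono ?_
    rw [Set.image_union]
    refine Set.union_subset_union_right _ ?_
    rintro _ ⟨_, ⟨y, hy, η, hη, rfl⟩, rfl⟩
    exact ⟨y, hy, η, hη, rfl⟩
  · rintro (b | b)
    exacts [(hc₁ b).symm, hg₁ _]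
  · rintro (b | b)
    exacts [(hc₁ b).symm, hg₁ _]

end SumRelation

end Transfer

/-! ### Strong dependence of a sum of strongly dependent structures. -/

section Main

open FirstOrder.Language FirstOrder.Language.Structure FirstOrder.Language.Theory

theorem preimage_image_union {N N₁ N₂ N' N₁' N₂' : Type*} {i₁ : N₁ → N} {i₂ : N₂ → N}
    {i₁' : N₁' → N'} {i₂' : N₂' → N'} {f : N → N'} {f₁ : N₁ → N₁'} {f₂ : N₂ → N₂'}
    (hinj : Function.Injective i₁') (hne : ∀ x y, i₁' x ≠ i₂' y)
    (h₁ : ∀ x, i₁' (f₁ x) = f (i₁ x)) (h₂ : ∀ x, i₂' (f₂ x) = f (i₂ x)) (A₁ : Set N₁)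
    (A₂ : Set N₂) : i₁' ⁻¹' (f '' (i₁ '' A₁ ∪ i₂ '' A₂)) = f₁ '' A₁ := by
  ext x
  constructor
  · rintro ⟨_, ⟨a, ha, rfl⟩ | ⟨a, ha, rfl⟩, h⟩
    · exact ⟨a, ha, hinj ((h₁ a).trans h)⟩
    · exact absurd (h.symm.trans (h₂ a).symm) (hne _ _)
  · rintro ⟨a, ha, rfl⟩
    exact ⟨i₁ a, Or.inl ⟨a, ha, rfl⟩, (h₁ a).symm⟩

theorem exists_not_typeForks {L : FirstOrder.Language.{u, v}} {T : L.Theory} {ℓ : IctKind}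
    (h : ¬ KappaIctGT ℓ T ℵ₀) {N N₀ : ModelType.{u, v, max u v} T} (f₀ : N ↪ₑ[L] N₀) (B : Set N)
    {μ : Type} [Finite μ] (c₀ : μ → N₀) :
    ∃ (n : ℕ) (A : Set N), A ⊆ B ∧ A.Finite ∧ ¬ TypeForks ℓ 2 n f₀ A B c₀ := by
  by_contra hcon
  push Not at hcon
  exact h (kappaIctGT_of_typeForks (by norm_num) hcon)

variable {τ : FirstOrder.Language.{u, v}} [τ.IsRelational] (M₁ : Type w₁) (M₂ : Type w₂)
  [Nonempty M₁] [Nonempty M₂] [τ.Structure M₁] [τ.Structure M₂]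

theorem isSumRelation_left : IsSumRelation SideRel.left (zeroRel M₁) (T₁ := τ.completeTheory M₁)
    (T₂ := τ.completeTheory M₂) (T := (sumLanguage τ).completeTheory (DisjointSum M₁ M₂))
    fun {_ _ _} i₁ i₂ => IsSum τ i₁ i₂ where
  isSide := fun h => h.isSide_left (zeroRel_iff M₁ _)
  cover := fun h x => h.cover x
  eqTp := fun h h' => h.eqTp h'
  exists_sum := exists_isSum
  exists_split := exists_split M₁ M₂

/-- With the roles of the sides exchanged, whatever is proved for the first part applies to the
right summand. -/
theorem isSumRelation_right : IsSumRelation SideRel.right (zeroRel M₂) (T₁ := τ.completeTheory M₂)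
    (T₂ := τ.completeTheory M₁) (T := (sumLanguage τ).completeTheory (DisjointSum M₁ M₂))
    fun {_ _ _} i₂ i₁ => IsSum τ i₁ i₂ where
  isSide := fun h => h.isSide_right (zeroRel_iff M₂ _)
  cover := fun h x => (h.cover x).symm
  eqTp := fun {_ _ _ _ _ _ _ _ _ _} h h' {_ _ _ _ _ _ _} h₁ h₂ {_ _} c hx hx' => h.eqTp h' h₂ h₁ (fun a => (c a).swap)
    (fun a => by rw [hx a]; rcases c a with b | b <;> rfl)
    (fun a => by rw [hx' a]; rcases c a with b | b <;> rfl)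
  exists_sum := fun N₂ N₁ => by
    obtain ⟨N, i₁, i₂, h⟩ := exists_isSum N₁ N₂
    exact ⟨N, i₂, i₁, h⟩
  exists_split := fun N => by
    obtain ⟨N₁, N₂, i₁, i₂, h⟩ := exists_split M₁ M₂ N
    exact ⟨N₂, N₁, i₂, i₁, h⟩

/-- A realization whose two parts are undistinguished is built, and the pairs which the given
configuration distinguishes on each side are counted. -/
theorem not_kappaIctGT_sum {ℓ : IctKind} (h₁ : ¬ KappaIctGT ℓ (τ.completeTheory M₁) ℵ₀)
    (h₂ : ¬ KappaIctGT ℓ (τ.completeTheory M₂) ℵ₀) :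
    ¬ KappaIctGT ℓ ((sumLanguage τ).completeTheory (DisjointSum M₁ M₂)) ℵ₀ := by
  classical
  intro h
  have hQ := isSumRelation_left (τ := τ) M₁ M₂
  have hQ' := isSumRelation_right (τ := τ) M₁ M₂
  obtain ⟨N, B, m, P, f₀, c₀, hfork⟩ := h.exists_typeForks
  obtain ⟨N₁, N₂, i₁, i₂, hN⟩ := exists_split M₁ M₂ N
  obtain ⟨P₁, P₂, j₁, j₂, hP⟩ := exists_split M₁ M₂ P
  obtain ⟨f₀₁, hf₀₁⟩ := (hQ.isSide hN).exists_restrict (hQ.isSide hP) f₀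
  obtain ⟨f₀₂, hf₀₂⟩ := (hQ'.isSide hN).exists_restrict (hQ'.isSide hP) f₀
  choose c₁₀ hc₁₀ using fun i : {i // ∃ a, c₀ i = j₁ a} => i.2
  choose c₂₀ hc₂₀ using fun i : {i // ∃ a, c₀ i = j₂ a} => i.2
  obtain ⟨n₁, A₁, hA₁, hfin₁, hT₁⟩ := exists_not_typeForks h₁ f₀₁ (i₁ ⁻¹' B) c₁₀
  obtain ⟨n₂, A₂, hA₂, hfin₂, hT₂⟩ := exists_not_typeForks h₂ f₀₂ (i₂ ⁻¹' B) c₂₀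
  -- The gap is the one which `Config.card_differs_lt` needs for `2 * n₁ + 2 * n₂` pairs.
  obtain ⟨N', f, hf⟩ := hfork (4 * (2 * n₁ + 2 * n₂ + 3) + 10) (2 * n₁ + 2 * n₂)
    (i₁ '' A₁ ∪ i₂ '' A₂) (by omega)
    (Set.union_subset (Set.image_subset_iff.2 hA₁) (Set.image_subset_iff.2 hA₂))
    ((hfin₁.image _).union (hfin₂.image _))
  obtain ⟨N₁', N₂', i₁', i₂', hN'⟩ := exists_split M₁ M₂ N'
  obtain ⟨f₁, hf₁⟩ := (hQ.isSide hN).exists_restrict (hQ.isSide hN') f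
  obtain ⟨f₂, hf₂⟩ := (hQ'.isSide hN).exists_restrict (hQ'.isSide hN') f
  -- Applied to the two parts of `N'`, non-forking gives realizations which are undistinguished by
  -- any configuration there. They are found in unrelated extensions, whose sum then extends `N'`.
  unfold TypeForks at hT₁ hT₂
  push Not at hT₁ hT₂
  obtain ⟨N₁'', g₁, c₁, hc₁, hd₁⟩ := hT₁ N₁' f₁
  obtain ⟨N₂'', g₂, c₂, hc₂, hd₂⟩ := hT₂ N₂' f₂
  obtain ⟨N'', k₁, k₂, hN''⟩ := exists_isSum N₁'' N₂''
  obtain ⟨g, hg₁, hg₂⟩ := hQ.exists_join hN' hN'' g₁ g₂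
  have hcl : ∀ i, ∃ d : {i // ∃ a, c₀ i = j₁ a} ⊕ {i // ∃ a, c₀ i = j₂ a},
      c₀ i = Sum.elim (j₁ ∘ c₁₀) (j₂ ∘ c₂₀) d := fun i => by
    rcases hP.cover (c₀ i) with ⟨a, ha⟩ | ⟨a, ha⟩
    exacts [⟨Sum.inl ⟨i, a, ha.symm⟩, hc₁₀ ⟨i, _⟩⟩, ⟨Sum.inr ⟨i, a, ha.symm⟩, hc₂₀ ⟨i, _⟩⟩]
  choose d hd using hcl
  have hclB : ∀ b : B, ∃ d : ↥(i₁ ⁻¹' B) ⊕ ↥(i₂ ⁻¹' B),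
      (b : N) = Sum.elim (fun b : ↥(i₁ ⁻¹' B) => i₁ b) (fun b : ↥(i₂ ⁻¹' B) => i₂ b) d := by
    rintro ⟨b, hb⟩
    rcases hN.cover b with ⟨a, rfl⟩ | ⟨a, rfl⟩
    exacts [⟨Sum.inl ⟨a, hb⟩, rfl⟩, ⟨Sum.inr ⟨a, hb⟩, rfl⟩]
  choose dB hdB using hclB
  have hc : EqTp (sumLanguage τ)
      (Sum.elim (fun b : B => g (f b)) fun i => Sum.elim (k₁ ∘ c₁) (k₂ ∘ c₂) (d i))
      (Sum.elim (fun b : B => f₀ b) c₀) := by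
    refine hN''.eqTp hP hc₁ hc₂ (Sum.elim (fun b => Sum.map Sum.inl Sum.inl (dB b))
      fun i => Sum.map Sum.inr Sum.inr (d i)) ?_ ?_
    · rintro (b | i)
      · simp only [Sum.elim_inl, hdB b]
        rcases dB b with b | b
        · simp [← hf₁, hg₁]
        · simp [← hf₂, hg₂]
      · simp only [Sum.elim_inr]
        rcases d i with b | b <;> rfl
    · rintro (b | i)
      · simp only [Sum.elim_inl, hdB b]
        rcases dB b with b | b
        · simp [← hf₀₁]
        · simp [← hf₀₂]
      · simp only [Sum.elim_inr, hd i]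
        rcases d i with b | b <;> rfl
  obtain ⟨S, t, ht, hdiff⟩ := hf N'' g _ hc
  obtain ⟨S₁, e₁, hS₁, hr₁, hp₁⟩ := Config.exists_side (hQ.isSide hN') S
  obtain ⟨S₂, e₂, hS₂, hr₂, hp₂⟩ := Config.exists_side (hQ'.isSide hN') S
  rw [← preimage_image_union (hQ.isSide hN').inj hN'.ne hf₁ hf₂ A₁ A₂] at hd₁
  rw [← preimage_image_union (hQ'.isSide hN').inj (fun x y => (hN'.ne y x).symm) hf₂ hf₁ A₂ A₁,
    Set.union_comm] at hd₂
  have hcard₁ := Config.card_differs_lt (n := 2 * n₁ + 2 * n₂) hd₁ S₁ le_rfl ht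
  have hcard₂ := Config.card_differs_lt (n := 2 * n₁ + 2 * n₂) hd₂ S₂ le_rfl ht
  -- Fewer than `2 * n₁` pairs are distinguished on the left and fewer than `2 * n₂` on the right,
  -- so some pair escapes both.
  obtain ⟨i, hi, hi₁, hi₂⟩ : ∃ i < 2 * n₁ + 2 * n₂,
      ¬ S₁.Differs g₁ c₁ (fun j => (4 * (2 * n₁ + 2 * n₂ + 3) + 10) * j) t i ∧
      ¬ S₂.Differs g₂ c₂ (fun j => (4 * (2 * n₁ + 2 * n₂ + 3) + 10) * j) t i := by
    by_contra hcon
    push Not at hcon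
    have hsub := Finset.card_le_card (s := Finset.range (2 * n₁ + 2 * n₂))
      (t := (Finset.range (2 * n₁ + 2 * n₂)).filter (fun i =>
        S₁.Differs g₁ c₁ (fun j => (4 * (2 * n₁ + 2 * n₂ + 3) + 10) * j) t i) ∪
        (Finset.range (2 * n₁ + 2 * n₂)).filter (fun i =>
        S₂.Differs g₂ c₂ (fun j => (4 * (2 * n₁ + 2 * n₂ + 3) + 10) * j) t i)) fun i hi => by
      rw [Finset.mem_union, Finset.mem_filter, Finset.mem_filter]
      by_cases h : S₁.Differs g₁ c₁ (fun j => (4 * (2 * n₁ + 2 * n₂ + 3) + 10) * j) t i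
      exacts [Or.inl ⟨hi, h⟩, Or.inr ⟨hi, hcon i (Finset.mem_range.1 hi) h⟩]
    have := hsub.trans (Finset.card_union_le _ _)
    rw [Finset.card_range] at this
    omega
  rw [Config.Differs, not_not] at hi₁ hi₂
  have hclκ : ∀ x : S.κ, ∃ d : S₁.κ ⊕ S₂.κ, x = Sum.elim e₁ e₂ d := fun x => by
    rcases hN'.cover (S.a 0 x) with ⟨a, ha⟩ | ⟨a, ha⟩
    · obtain ⟨y, hy⟩ := hr₁ 0 x ⟨a, ha.symm⟩
      exact ⟨Sum.inl y, hy.symm⟩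
    · obtain ⟨y, hy⟩ := hr₂ 0 x ⟨a, ha.symm⟩
      exact ⟨Sum.inr y, hy.symm⟩
  choose dκ hdκ using hclκ
  have hx : ∀ (r : ℕ) (a : Fin m ⊕ S.κ),
      Sum.elim (fun i => Sum.elim (k₁ ∘ c₁) (k₂ ∘ c₂) (d i)) (g ∘ S.a r) a =
      Sum.elim (k₁ ∘ Sum.elim c₁ (g₁ ∘ S₁.a r)) (k₂ ∘ Sum.elim c₂ (g₂ ∘ S₂.a r))
        (Sum.elim (fun i => Sum.map Sum.inl Sum.inl (d i))
          (fun x => Sum.map Sum.inr Sum.inr (dκ x)) a) := by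
    rintro r (a | x)
    · simp only [Sum.elim_inl]
      rcases d a with b | b <;> rfl
    · simp only [Sum.elim_inr, Function.comp_apply]
      conv_lhs => rw [hdκ x]
      rcases dκ x with y | y
      · simp [← hS₁, hg₁]
      · simp [← hS₂, hg₂]
  refine hdiff i hi (hQ.sameType hN'' ?_ hi₁ hi₂ _ (hx _) (hx _))
  rintro _ ⟨x, hx, rfl⟩
  rcases hN'.cover x with ⟨a, rfl⟩ | ⟨a, rfl⟩
  · exact Or.inl ⟨_, ⟨a, hx.imp id (hp₁ _ _ _), rfl⟩, (hg₁ a).symm⟩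
  · exact Or.inr ⟨_, ⟨a, hx.imp id (hp₂ _ _ _), rfl⟩, (hg₂ a).symm⟩

end Main

end StrongDep

theorem mainTheorem3 {τ : FirstOrder.Language.{u, v}} [τ.IsRelational]
    (M₁ : Type w₁) (M₂ : Type w₂) [Nonempty M₁] [Nonempty M₂]
    [τ.Structure M₁] [τ.Structure M₂] (ℓ : StrongDep.IctKind) :
    StrongDep.StronglyDependent ℓ
        ((StrongDep.sumLanguage τ).completeTheory (StrongDep.DisjointSum M₁ M₂)) ↔
      StrongDep.StronglyDependent ℓ (τ.completeTheory M₁) ∧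
        StrongDep.StronglyDependent ℓ (τ.completeTheory M₂) := by
  refine ⟨fun h => ⟨fun h₁ => h ?_, fun h₂ => h ?_⟩, fun h =>
    StrongDep.not_kappaIctGT_sum M₁ M₂ h.1 h.2⟩
  · exact (StrongDep.isSumRelation_left M₁ M₂).kappaIctGT
      (FirstOrder.Language.completeTheory.isSatisfiable _ M₂) h₁
  · exact (StrongDep.isSumRelation_right M₁ M₂).kappaIctGT
      (FirstOrder.Language.completeTheory.isSatisfiable _ M₁) h₂
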